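/- **Theorem 1 (Coarse achievability for compound-dispersion channels).** *Setting.* Let $W(y|x)$ be a discrete memoryless channel with finite input alphabet $\mathcal X\neq\emptyset$ and finite output alphabet $\mathcal Y$; logarithms are natural. Let $C=\max_P I(P;W)$ be its capacity and $\Pi^*$ the set of input distributions $P$ with $I(P;W)=C$. All $P\in\Pi^*$ induce the same output distribution $q^*(y)=\sum_x P(x)W(y|x)$. Let $\nu_x$ be the variance of $\log\frac{W(Y|x)}{q^*(Y)}$ for $Y\sim W(\cdot|x)$, let $V(P)=\sum_x P(x)\nu_x$, and put $V_{\min}=\min_{P\in\Pi^*}V(P)$, $V_{\max}=\max_{P\in\Pi^*}V(P)$. The channel is *compound-dispersion* if $V_{\min}>0$ and $V_{\min}\ne V_{\max}$. An $(n,R)$ code with feedback has $\lceil e^{nR}\rceil$ messages, an encoder whose $k$-th input is a function of the message and of the outputs $y_1,\dots,y_{k-1}$, and a decoder which estimates the message from $y_1,\dots,y_n$. Let $M^*_{\mathrm{fb}}(n,\varepsilon)$ be the largest value of $\lceil e^{nR}\rceil$, $R\in\mathbb R$, for which the minimum average error probability (over equiprobable messages) of $(n,R)$ codes with feedback is at most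 $\varepsilon$. Let $\Phi$ and $\phi$ be the distribution function and density of the standard Gaussian law. *Claim.* Let $W$ be compound-dispersion, $0<\varepsilon<\frac12$, $\beta=\sqrt{V_{\min}/V_{\max}}$ and $$f(\alpha)=\varepsilon(\alpha-1)-(1-\beta)\,\phi\bigl(2\sqrt2\,\Phi^{-1}(\alpha\varepsilon)\bigr)\Bigl(\tfrac1{\sqrt{2\pi}}-\phi\bigl(\sqrt2\,\Phi^{-1}(\alpha\varepsilon)\bigr)\Bigr).$$ Then there is an $\alpha$ with $1<\alpha<\frac1{2\varepsilon}$ and $f(\alpha)<0$. For every such $\alpha$, $$\liminf_{n\to\infty}\frac{\log M^*_{\mathrm{fb}}(n,\varepsilon)-nC}{\sqrt n}\;\ge\;\sqrt{V_{\min}}\,\Phi^{-1}(\alpha\varepsilon)\;>\;\sqrt{V_{\min}}\,\Phi^{-1}(\varepsilon).$$ Moreover, this rate is achieved by random codes that switch input distribution at most once, at the halfway point. That is, there are $Q_{\min},Q_{\max}\in\Pi^*$ with $V(Q_{\min})=V_{\min}$ and $V(Q_{\max})=V_{\max}$, and for each $n$ a set $S_n\subseteq\mathcal X^{\lfloor n/2\rfloor}\times\mathcal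 Y^{\lfloor n/2\rfloor}$, such that for every $r<\sqrt{V_{\min}}\,\Phi^{-1}(\alpha\varepsilon)$ and all sufficiently large $n$ the following random code with $M=\lceil e^{nC+r\sqrt n}\rceil$ messages has expected average error probability at most $\varepsilon$ under optimal decoding. Every message $m$ owns two words $a_m,b_m\in\mathcal X^n$; all symbols of all words are independent, those of the $a_m$ with law $Q_{\min}$ and those of the $b_m$ with law $Q_{\max}$. To send $m$, the encoder uses $a_m$ during the first $\lfloor n/2\rfloor$ channel uses; for all the remaining uses it takes the corresponding symbols of $b_m$ if the pair of first-half inputs and outputs lies in $S_n$, and those of $a_m$ otherwise. -/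

import Mathlib

open scoped BigOperators

noncomputable section

/-- A discrete memoryless channel: a stochastic matrix from a finite input alphabet `X` to a finite
output alphabet `Y`; `W.prob x y` is `W(y|x)`. -/
structure Channel (X Y : Type*) [Fintype Y] where
  prob : X → Y → ℝ
  prob_nonneg : ∀ x y, 0 ≤ prob x y
  prob_sum : ∀ x, ∑ y, prob x y = 1

namespace Channel

variable {X Y : Type*} [Fintype X] [Fintype Y]

/-- The output distribution `y ↦ ∑ x, P(x) W(y|x)` induced by the input distribution `P`. -/
def outDist (W : Channel X Y) (P : X → ℝ) (y : Y) : ℝ := ∑ x, P x * W.prob x y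

/-- The mutual information `I(P;W)`, in nats (a term with `P(x) W(y|x) = 0` contributes `0`). -/
def mutualInfo (W : Channel X Y) (P : X → ℝ) : ℝ :=
  ∑ x, ∑ y, P x * W.prob x y * Real.log (W.prob x y / W.outDist P y)

/-- The capacity `C`, the maximum of `I(P;W)` over the input distributions `P`. -/
def capacity (W : Channel X Y) : ℝ := sSup (W.mutualInfo '' stdSimplex ℝ X)

/-- The set `Π*` of capacity-achieving input distributions. -/
def capAchieving (W : Channel X Y) : Set (X → ℝ) :=
  {P | P ∈ stdSimplex ℝ X ∧ W.mutualInfo P = W.capacity}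

theorem mutualInfo_eq (W : Channel X Y) {P : X → ℝ} (hP : P ∈ stdSimplex ℝ X) :
    W.mutualInfo P = ∑ y, Real.negMulLog (W.outDist P y)
      - ∑ x, P x * ∑ y, Real.negMulLog (W.prob x y) := by
  have h1 : ∀ x y, P x * W.prob x y * Real.log (W.prob x y / W.outDist P y) =
      P x * W.prob x y * Real.log (W.prob x y)
        - P x * W.prob x y * Real.log (W.outDist P y) := by
    intro x y
    by_cases h : P x * W.prob x y = 0
    · simp [h]
    · have hw : W.prob x y ≠ 0 := fun h' => h (by simp [h'])
      have ho : W.outDist P y ≠ 0 := by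
        have hpos : 0 < P x * W.prob x y :=
          lt_of_le_of_ne (mul_nonneg (hP.1 x) (W.prob_nonneg x y)) (Ne.symm h)
        have : P x * W.prob x y ≤ W.outDist P y :=
          Finset.single_le_sum (f := fun x => P x * W.prob x y)
            (fun i _ => mul_nonneg (hP.1 i) (W.prob_nonneg i y)) (Finset.mem_univ x)
        linarith
      rw [Real.log_div hw ho]; ring
  have h2 : ∑ x, ∑ y, P x * W.prob x y * Real.log (W.outDist P y) =
      - ∑ y, Real.negMulLog (W.outDist P y) := by
    rw [Finset.sum_comm, ← Finset.sum_neg_distrib]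
    refine Finset.sum_congr rfl fun y _ => ?_
    rw [← Finset.sum_mul, Real.negMulLog]
    simp only [outDist]; ring
  have h3 : ∑ x, ∑ y, P x * W.prob x y * Real.log (W.prob x y) =
      - ∑ x, P x * ∑ y, Real.negMulLog (W.prob x y) := by
    rw [← Finset.sum_neg_distrib]
    refine Finset.sum_congr rfl fun x _ => ?_
    rw [Finset.mul_sum, ← Finset.sum_neg_distrib]
    refine Finset.sum_congr rfl fun y _ => ?_
    rw [Real.negMulLog]; ring
  simp only [mutualInfo, h1, Finset.sum_sub_distrib, h2, h3]
  ring

theorem isMaxOn_exists (W : Channel X Y) [Nonempty X] :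
    ∃ P ∈ stdSimplex ℝ X, IsMaxOn W.mutualInfo (stdSimplex ℝ X) P := by
  classical
  have hne : (stdSimplex ℝ X).Nonempty :=
    ⟨_, single_mem_stdSimplex ℝ (Classical.arbitrary X)⟩
  refine (isCompact_stdSimplex ℝ X).exists_isMaxOn hne ?_
  have hc : Continuous fun P : X → ℝ => ∑ y, Real.negMulLog (W.outDist P y)
      - ∑ x, P x * ∑ y, Real.negMulLog (W.prob x y) := by
    unfold outDist
    have := Real.continuous_negMulLog
    fun_prop
  exact hc.continuousOn.congr fun P hP => W.mutualInfo_eq hP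

/-- The capacity is attained. -/
theorem capAchieving_nonempty (W : Channel X Y) [Nonempty X] : W.capAchieving.Nonempty := by
  obtain ⟨P, hP, hmax⟩ := W.isMaxOn_exists
  have hg : IsGreatest (W.mutualInfo '' stdSimplex ℝ X) (W.mutualInfo P) := by
    refine ⟨⟨P, hP, rfl⟩, ?_⟩
    rintro _ ⟨Q, hQ, rfl⟩
    exact hmax hQ
  exact ⟨P, hP, hg.csSup_eq.symm⟩

theorem mutualInfo_le_capacity (W : Channel X Y) {P : X → ℝ} (hP : P ∈ stdSimplex ℝ X) :
    W.mutualInfo P ≤ W.capacity := by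
  have : Nonempty X := by
    by_contra h
    rw [not_nonempty_iff] at h
    have := hP.2
    simp at this
  obtain ⟨Q, _, hmax⟩ := W.isMaxOn_exists
  refine le_csSup ⟨W.mutualInfo Q, ?_⟩ ⟨P, hP, rfl⟩
  rintro _ ⟨Q', hQ', rfl⟩
  exact hmax hQ'

/-- All capacity-achieving input distributions induce the same output distribution. -/
theorem outDist_unique (W : Channel X Y) {P Q : X → ℝ} (hP : P ∈ W.capAchieving)
    (hQ : Q ∈ W.capAchieving) : W.outDist P = W.outDist Q := by
  by_contra hne
  obtain ⟨y₀, hy₀⟩ := Function.ne_iff.mp hne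
  set R : X → ℝ := (1 / 2 : ℝ) • P + (1 / 2 : ℝ) • Q with hR
  have hRs : R ∈ stdSimplex ℝ X :=
    convex_stdSimplex ℝ X hP.1 hQ.1 (by norm_num) (by norm_num) (by norm_num)
  have hout : ∀ y, W.outDist R y = (1 / 2 : ℝ) • W.outDist P y + (1 / 2 : ℝ) • W.outDist Q y := by
    intro y
    simp only [outDist, hR, Pi.add_apply, Pi.smul_apply, smul_eq_mul, Finset.mul_sum,
      ← Finset.sum_add_distrib]
    exact Finset.sum_congr rfl fun x _ => by ring
  have hnn : ∀ {S : X → ℝ}, S ∈ stdSimplex ℝ X → ∀ y, W.outDist S y ∈ Set.Ici (0 : ℝ) :=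
    fun hS y => Finset.sum_nonneg fun x _ => mul_nonneg (hS.1 x) (W.prob_nonneg x y)
  have hlt : ∑ y, ((1 / 2 : ℝ) • Real.negMulLog (W.outDist P y)
      + (1 / 2 : ℝ) • Real.negMulLog (W.outDist Q y)) < ∑ y, Real.negMulLog (W.outDist R y) := by
    refine Finset.sum_lt_sum (fun y _ => ?_) ⟨y₀, Finset.mem_univ _, ?_⟩
    · rw [hout]
      exact Real.concaveOn_negMulLog.2 (hnn hP.1 y) (hnn hQ.1 y) (by norm_num) (by norm_num)
        (by norm_num)
    · rw [hout]
      exact Real.strictConcaveOn_negMulLog.2 (hnn hP.1 y₀) (hnn hQ.1 y₀) hy₀ (by norm_num)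
        (by norm_num) (by norm_num)
  have hlin : ∑ x, R x * ∑ y, Real.negMulLog (W.prob x y) =
      (1 / 2) * (∑ x, P x * ∑ y, Real.negMulLog (W.prob x y))
      + (1 / 2) * (∑ x, Q x * ∑ y, Real.negMulLog (W.prob x y)) := by
    rw [Finset.mul_sum, Finset.mul_sum, ← Finset.sum_add_distrib]
    refine Finset.sum_congr rfl fun x _ => ?_
    simp only [hR, Pi.add_apply, Pi.smul_apply, smul_eq_mul]
    ring
  have e1 := W.mutualInfo_eq hP.1
  have e2 := W.mutualInfo_eq hQ.1
  have e3 := W.mutualInfo_eq hRs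
  rw [hP.2] at e1
  rw [hQ.2] at e2
  have e4 := W.mutualInfo_le_capacity hRs
  simp only [smul_eq_mul, Finset.sum_add_distrib, ← Finset.mul_sum] at hlt
  linarith

variable [Nonempty X]

/-- The common output distribution `q*` of all capacity-achieving input distributions. -/
def qStar (W : Channel X Y) : Y → ℝ := W.outDist W.capAchieving_nonempty.choose

theorem qStar_eq (W : Channel X Y) {P : X → ℝ} (hP : P ∈ W.capAchieving) (y : Y) :
    W.qStar y = ∑ x, P x * W.prob x y :=
  congrFun (W.outDist_unique W.capAchieving_nonempty.choose_spec hP) y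

/-- The information density `i*(x,y) = log (W(y|x) / q*(y))`. -/
def infoDensity (W : Channel X Y) (x : X) (y : Y) : ℝ := Real.log (W.prob x y / W.qStar y)

/-- The conditional variance `ν_x = Var[i*(X,Y) | X = x]`, where `Y` has law `W(·|x)`. -/
def condVar (W : Channel X Y) (x : X) : ℝ :=
  ∑ y, W.prob x y * (W.infoDensity x y - ∑ y', W.prob x y' * W.infoDensity x y') ^ 2

/-- The dispersion `∑ x, P(x) ν_x` of the input distribution `P`. -/
def dispersion (W : Channel X Y) (P : X → ℝ) : ℝ := ∑ x, P x * W.condVar x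

/-- `V_min`, the least dispersion of a capacity-achieving input distribution. -/
def Vmin (W : Channel X Y) : ℝ := sInf (W.dispersion '' W.capAchieving)

/-- `V_max`, the greatest dispersion of a capacity-achieving input distribution. -/
def Vmax (W : Channel X Y) : ℝ := sSup (W.dispersion '' W.capAchieving)

/-- A channel is compound-dispersion if `V_min > 0` and `V_min ≠ V_max`. -/
def IsCompoundDispersion (W : Channel X Y) : Prop := 0 < W.Vmin ∧ W.Vmin ≠ W.Vmax

end Channel

/-- A code with ideal feedback of block length `n` with `M` messages. At time `k` the encoder sees
the message and the outputs received before time `k` (times run from `0` to `n - 1`). -/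
structure FeedbackCode (X Y : Type*) (n M : ℕ) where
  encoder : Fin M → (k : Fin n) → (Fin k → Y) → X
  decoder : (Fin n → Y) → Fin M

/-- The average error probability, over equiprobable messages, of a feedback code used over `W`. -/
def avgError {X Y : Type*} [Fintype Y] (W : Channel X Y) {n M : ℕ} (c : FeedbackCode X Y n M) :
    ℝ :=
  (1 / (M : ℝ)) * ∑ m : Fin M, ∑ y : Fin n → Y,
    if c.decoder y ≠ m then
      ∏ k : Fin n, W.prob (c.encoder m k fun j => y ⟨j, j.isLt.trans k.isLt⟩) (y k)
    else 0

/-- The minimum average error probability of an `(n,R)` code with feedback; such a code has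
`⌈exp(nR)⌉` messages. -/
def minErrorFb {X Y : Type*} [Fintype Y] (W : Channel X Y) (n : ℕ) (R : ℝ) : ℝ :=
  ⨅ c : FeedbackCode X Y n ⌈Real.exp (n * R)⌉₊, avgError W c

/-- `M*_fb(n,ε)`, the largest number of messages `⌈exp(nR)⌉` for which the minimum average error
probability with feedback is at most `ε`. -/
def maxMessagesFb {X Y : Type*} [Fintype Y] (W : Channel X Y) (n : ℕ) (ε : ℝ) : ℕ :=
  sSup {M : ℕ | ∃ R : ℝ, M = ⌈Real.exp (n * R)⌉₊ ∧ minErrorFb W n R ≤ ε}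

/-- The second-order coding rate with feedback at average error probability `ε`. -/
def secondOrderRateFb {X Y : Type*} [Fintype X] [Fintype Y] (W : Channel X Y) (ε : ℝ) : EReal :=
  Filter.liminf (fun n : ℕ =>
    (((Real.log (maxMessagesFb W n ε) - n * W.capacity) / √(n : ℝ) : ℝ) : EReal)) Filter.atTop

/-- The standard Gaussian distribution function `Φ`. -/
def gaussianCDF (x : ℝ) : ℝ := ProbabilityTheory.cdf (ProbabilityTheory.gaussianReal 0 1) x

/-- The standard Gaussian density `φ`. -/
def gaussianDensity (x : ℝ) : ℝ := ProbabilityTheory.gaussianPDFReal 0 1 x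

/-- The inverse `Φ⁻¹` of `Φ` on `(0,1)`, written as the quantile function. -/
def gaussianQuantile (p : ℝ) : ℝ := sInf {x : ℝ | p ≤ gaussianCDF x}

/-- The function `f(α)` for `β = √(V_min / V_max)`. -/
def coarseGap {X Y : Type*} [Fintype X] [Nonempty X] [Fintype Y] (W : Channel X Y) (ε α : ℝ) : ℝ :=
  ε * (α - 1) - (1 - √(W.Vmin / W.Vmax))
    * gaussianDensity (2 * √2 * gaussianQuantile (α * ε))
    * (1 / √(2 * Real.pi) - gaussianDensity (√2 * gaussianQuantile (α * ε)))

open Classical in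
/-- The encoder that switches at most once, at the halfway point. Message `m` owns the two words
`a m` and `b m`. The encoder sends `a m` during the first `n / 2` uses. For the remaining uses it
sends `b m` if the first-half inputs and outputs lie in the set `S`, and `a m` otherwise. -/
def oneSwitchEncoder {X Y : Type*} {n M : ℕ} (S : Set ((Fin (n / 2) → X) × (Fin (n / 2) → Y)))
    (a b : Fin M → Fin n → X) (m : Fin M) (k : Fin n) (y : Fin k → Y) : X :=
  if h : (k : ℕ) < n / 2 then a m k
  else if ((fun j : Fin (n / 2) => a m ⟨j, j.isLt.trans_le (Nat.div_le_self n 2)⟩),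
      (fun j : Fin (n / 2) => y ⟨j, j.isLt.trans_le (not_lt.mp h)⟩)) ∈ S then b m k
  else a m k

/-- The expected value, over the random code with encoder `oneSwitchEncoder S a b` in which all
symbols of all words `a m` and `b m` are drawn independently, those of `a m` from `P` and those of
`b m` from `Q`, of the average error probability under the best decoder. -/
def oneSwitchEnsembleError {X Y : Type*} [Fintype X] [Fintype Y] (W : Channel X Y) (n M : ℕ)
    (S : Set ((Fin (n / 2) → X) × (Fin (n / 2) → Y))) (P Q : X → ℝ) : ℝ :=
  ∑ a : Fin M → Fin n → X, ∑ b : Fin M → Fin n → X,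
    (∏ m, ∏ k, P (a m k)) * (∏ m, ∏ k, Q (b m k)) *
      ⨅ g : (Fin n → Y) → Fin M, avgError W ⟨oneSwitchEncoder S a b, g⟩

end

open scoped BigOperators

noncomputable section

open MeasureTheory ProbabilityTheory Filter Set Topology

/-! Every capacity-achieving input distribution induces the same output law `q*`, so the outputs of
the random code are i.i.d. `q*` whatever the switching rule. The usual random coding argument
therefore survives feedback. A decoder that compares the likelihood with `K` times the output law,
where `K = exp(nC + T√n)`, errs with expected probability at most that of a total centered
information density below `T√n`, plus `(M - 1)/K` (`random_coding_bound`,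
`oneSwitchEnsembleError_le`). The last term vanishes when `M` is about `exp(nC + r√n)` with `r < T`.

By the KKT conditions each used input letter has mean information density exactly `C`, so the
centered density has mean `0` and variance `V(P)`. The central limit theorem on the two halves
replaces the normalized sums by `s U` and by `s Z` (no switch) or `t Z` (switch), with `U`, `Z`
independent standard Gaussians, `s = √(V_min/2)`, `t = √(V_max/2)` and `β = s/t`.

Take `T = √V_min Φ⁻¹(αε)` and write `T = -s d` with `d > 0`. Without switching the limiting error is
`P(U + Z ≤ -d) = αε`. If `U ≤ -d`, the second half must exceed the nonnegative level `v = -d - U`; a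
larger variance then lowers the failure probability from `Φ(v)` to `Φ(βv)`. The total gain is at
least `(1 - β) φ(2d) (φ(0) - φ(d))` (`prod_gaussian_switch_le`), and `f(α) < 0` says that it exceeds
`(α - 1)ε`. As `α` decreases to `1` the gain stays away from `0`, so such `α` exist. -/

/-! ### Gaussian estimates and the gain from switching. -/

lemma gaussianDensity_eq (x : ℝ) :
    gaussianDensity x = (√(2 * Real.pi))⁻¹ * Real.exp (-x ^ 2 / 2) := by
  simp [gaussianDensity, gaussianPDFReal]

lemma gaussianDensity_zero : gaussianDensity 0 = 1 / √(2 * Real.pi) := by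
  simp [gaussianDensity_eq]

lemma gaussianDensity_pos (x : ℝ) : 0 < gaussianDensity x :=
  gaussianPDFReal_pos _ _ _ one_ne_zero

lemma gaussianDensity_neg (x : ℝ) : gaussianDensity (-x) = gaussianDensity x := by
  simp [gaussianDensity_eq]

lemma gaussianDensity_le_of_sq_le {x y : ℝ} (h : x ^ 2 ≤ y ^ 2) :
    gaussianDensity y ≤ gaussianDensity x := by
  rw [gaussianDensity_eq, gaussianDensity_eq]
  gcongr

lemma gaussianDensity_lt_zero {x : ℝ} (h : x ≠ 0) : gaussianDensity x < gaussianDensity 0 := by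
  rw [gaussianDensity_eq, gaussianDensity_eq]
  have : 0 < x ^ 2 := by positivity
  refine mul_lt_mul_of_pos_left (Real.exp_lt_exp.2 ?_) (by positivity)
  linarith

lemma hasDerivAt_gaussianDensity (x : ℝ) :
    HasDerivAt gaussianDensity (-x * gaussianDensity x) x := by
  have h : gaussianDensity = fun x => (√(2 * Real.pi))⁻¹ * Real.exp (-x ^ 2 / 2) :=
    funext gaussianDensity_eq
  rw [h]
  have h1 : HasDerivAt (fun x : ℝ => -x ^ 2 / 2) (-x) x := by
    have := ((hasDerivAt_pow 2 x).neg).div_const 2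
    convert! this using 1
    simp only [Nat.cast_ofNat, Nat.add_one_sub_one, pow_one]; ring
  convert! (h1.exp.const_mul _) using 1
  ring

lemma continuous_gaussianDensity : Continuous gaussianDensity :=
  continuous_iff_continuousAt.2 fun x => (hasDerivAt_gaussianDensity x).continuousAt

lemma gaussianCDF_eq_measure (x : ℝ) : gaussianCDF x = (gaussianReal 0 1).real (Iic x) :=
  cdf_eq_real _ _

lemma gaussianCDF_eq_integral (x : ℝ) : gaussianCDF x = ∫ t in Iic x, gaussianDensity t := by
  rw [gaussianCDF_eq_measure, measureReal_def, gaussianReal_apply_eq_integral _ one_ne_zero,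
    ENNReal.toReal_ofReal]
  · rfl
  · exact integral_nonneg fun t => gaussianPDFReal_nonneg _ _ _

lemma integrable_gaussianDensity : Integrable gaussianDensity := integrable_gaussianPDFReal 0 1

lemma hasDerivAt_gaussianCDF (x : ℝ) : HasDerivAt gaussianCDF (gaussianDensity x) x := by
  have h : gaussianCDF = fun x => gaussianCDF 0 + ∫ t in (0:ℝ)..x, gaussianDensity t := by
    funext x
    rw [gaussianCDF_eq_integral, gaussianCDF_eq_integral,
      ← intervalIntegral.integral_Iic_sub_Iic integrable_gaussianDensity.integrableOn
        integrable_gaussianDensity.integrableOn]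
    ring
  rw [h]
  exact (intervalIntegral.integral_hasDerivAt_right
    (continuous_gaussianDensity.intervalIntegrable _ _)
    continuous_gaussianDensity.aestronglyMeasurable.stronglyMeasurableAtFilter
    continuous_gaussianDensity.continuousAt).const_add _

lemma continuous_gaussianCDF : Continuous gaussianCDF :=
  continuous_iff_continuousAt.2 fun x => (hasDerivAt_gaussianCDF x).continuousAt

lemma gaussianCDF_strictMono : StrictMono gaussianCDF := by
  refine strictMono_of_deriv_pos fun x => ?_
  rw [(hasDerivAt_gaussianCDF x).deriv]
  exact gaussianDensity_pos x

lemma gaussianCDF_nonneg (x : ℝ) : 0 ≤ gaussianCDF x := cdf_nonneg _ _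

lemma gaussianCDF_le_one (x : ℝ) : gaussianCDF x ≤ 1 := cdf_le_one _ _

lemma gaussianCDF_quantile {p : ℝ} (h0 : 0 < p) (h1 : p < 1) :
    gaussianCDF (gaussianQuantile p) = p := by
  obtain ⟨a, ha⟩ := ((tendsto_cdf_atBot (gaussianReal 0 1)).eventually_lt_const h0).exists
  obtain ⟨b, hb⟩ := ((tendsto_cdf_atTop (gaussianReal 0 1)).eventually_const_lt h1).exists
  obtain ⟨x, hx⟩ := mem_range_of_exists_le_of_exists_ge continuous_gaussianCDF
    ⟨a, ha.le⟩ ⟨b, hb.le⟩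
  have : {y : ℝ | p ≤ gaussianCDF y} = Ici x := by
    ext y
    rw [mem_ofPred_eq, ← hx, gaussianCDF_strictMono.le_iff_le, mem_Ici]
  rw [gaussianQuantile, this, csInf_Ici, hx]

lemma gaussianQuantile_lt {p q : ℝ} (h0 : 0 < p) (hpq : p < q) (h1 : q < 1) :
    gaussianQuantile p < gaussianQuantile q := by
  rw [← gaussianCDF_strictMono.lt_iff_lt, gaussianCDF_quantile h0 (hpq.trans h1),
    gaussianCDF_quantile (h0.trans hpq) h1]
  exact hpq

lemma gaussianCDF_zero : gaussianCDF 0 = 1 / 2 := by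
  have : NullSingletonClass (gaussianReal 0 1) := nullSingletonClass_gaussianReal one_ne_zero
  have h1 : (gaussianReal 0 1).real (Ici 0) = gaussianCDF 0 := by
    rw [gaussianCDF_eq_measure, measureReal_def, measureReal_def]
    congr 1
    conv_lhs => rw [← neg_zero, ← gaussianReal_map_neg, Measure.map_apply measurable_neg
      measurableSet_Ici]
    simp
  have h2 : (gaussianReal 0 1).real (Ici 0) = (gaussianReal 0 1).real (Ioi 0) :=
    measureReal_congr Ioi_ae_eq_Ici.symm
  have h3 := probReal_compl_eq_one_sub (μ := gaussianReal 0 1) (measurableSet_Iic (a := (0 : ℝ)))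
  rw [compl_Iic, ← h2, h1, ← gaussianCDF_eq_measure] at h3
  linarith

lemma gaussianQuantile_neg {p : ℝ} (h0 : 0 < p) (h1 : p < 1 / 2) : gaussianQuantile p < 0 := by
  rw [← gaussianCDF_strictMono.lt_iff_lt, gaussianCDF_quantile h0 (by linarith), gaussianCDF_zero]
  exact h1

/-- Mean value theorem on `[βv, v]`, where the density is smallest at the right endpoint. -/
lemma le_gaussianCDF_sub {β v : ℝ} (hβ : 0 ≤ β) (hβ' : β ≤ 1) (hv : 0 ≤ v) :
    (1 - β) * v * gaussianDensity v ≤ gaussianCDF v - gaussianCDF (β * v) := by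
  rcases (mul_le_of_le_one_left hv hβ').eq_or_lt with h | h
  · have : (1 - β) * v = 0 := by linarith
    rw [this, h]; simp
  · obtain ⟨ξ, hξ, e⟩ := exists_hasDerivAt_eq_slope gaussianCDF gaussianDensity h
      continuous_gaussianCDF.continuousOn fun x _ => hasDerivAt_gaussianCDF x
    have hpos : 0 < v - β * v := by linarith
    rw [eq_div_iff hpos.ne'] at e
    rw [← e]
    have h0 : 0 ≤ ξ := (mul_nonneg hβ hv).trans hξ.1.le
    have : gaussianDensity v ≤ gaussianDensity ξ :=
      gaussianDensity_le_of_sq_le (pow_le_pow_left₀ h0 hξ.2.le 2)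
    nlinarith

/-- Fubini, conditioning on the first coordinate. -/
lemma prod_gaussian_real {A : Set ℝ} (hA : MeasurableSet A) {g : ℝ → ℝ} (hg : Measurable g) :
    ((gaussianReal 0 1).prod (gaussianReal 0 1)).real {p | p.1 ∈ A ∧ p.2 ≤ g p.1} =
      ∫ u in A, gaussianDensity u * gaussianCDF (g u) := by
  have hm : MeasurableSet {p : ℝ × ℝ | p.1 ∈ A ∧ p.2 ≤ g p.1} :=
    (measurable_fst hA).inter (measurableSet_le measurable_snd (hg.comp measurable_fst))
  have h1 : ∀ u, (gaussianReal 0 1) (Prod.mk u ⁻¹' {p | p.1 ∈ A ∧ p.2 ≤ g p.1}) =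
      ENNReal.ofReal (A.indicator (fun u => gaussianCDF (g u)) u) := by
    intro u
    by_cases hu : u ∈ A
    · rw [indicator_of_mem hu, gaussianCDF_eq_measure, ofReal_measureReal]
      congr 1
      ext w; simp [hu]
    · simp [hu]
  rw [measureReal_def, Measure.prod_apply hm]
  simp_rw [h1]
  rw [← integral_eq_lintegral_of_nonneg_ae, integral_gaussianReal_eq_integral_smul one_ne_zero,
    ← integral_indicator hA]
  · refine integral_congr_ae (ae_of_all _ fun u => ?_)
    by_cases hu : u ∈ A <;> simp [hu, gaussianDensity]
  · exact ae_of_all _ fun u => indicator_nonneg (fun _ _ => gaussianCDF_nonneg _) u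
  · exact ((continuous_gaussianCDF.measurable.comp hg).indicator hA).aestronglyMeasurable

lemma integrable_density_mul_cdf {g : ℝ → ℝ} (hg : Measurable g) :
    Integrable fun u => gaussianDensity u * gaussianCDF (g u) := by
  refine integrable_gaussianDensity.mul_bdd (c := 1)
    (continuous_gaussianCDF.measurable.comp hg).aestronglyMeasurable (ae_of_all _ fun u => ?_)
  rw [Real.norm_eq_abs, abs_of_nonneg (gaussianCDF_nonneg _)]
  exact gaussianCDF_le_one _

lemma prod_gaussian_add_le (t : ℝ) :
    ((gaussianReal 0 1).prod (gaussianReal 0 1)).real {p | p.2 ≤ t - p.1} =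
      gaussianCDF (t / √2) := by
  have h1 : (gaussianReal 0 1) ∗ (gaussianReal 0 1) =
      (gaussianReal 0 1).map (fun x => √2 * x) := by
    rw [gaussianReal_conv_gaussianReal, gaussianReal_map_const_mul]
    congr 1
    · simp
    · ext; norm_num
  have h2 := congrArg (fun m : Measure ℝ => m.real (Iic t)) h1
  simp only [Measure.conv] at h2
  rw [map_measureReal_apply (by fun_prop) measurableSet_Iic,
    map_measureReal_apply (by fun_prop) measurableSet_Iic] at h2
  rw [gaussianCDF_eq_measure]
  convert! h2 using 2
  · ext p; simp only [mem_ofPred_eq, mem_preimage, mem_Iic]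
    constructor <;> intro h <;> linarith
  · ext p; simp only [mem_preimage, mem_Iic]
    rw [le_div_iff₀ (by positivity), mul_comm]

/-- The integrand is nonnegative for `u ≤ -d`, so it may be restricted to the window `(-2d, -d]`.
There `φ(u) ≥ φ(2d)`, and with `v = -d - u` the bound `(1 - β) v φ(v)` of `le_gaussianCDF_sub`
integrates exactly, because `v φ(v) = -φ'(v)`. -/
lemma switch_gain_integral {β d : ℝ} (hβ : 0 ≤ β) (hβ' : β ≤ 1) (hd : 0 ≤ d) :
    (1 - β) * gaussianDensity (2 * d) * (gaussianDensity 0 - gaussianDensity d) ≤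
      ∫ u in Iic (-d), gaussianDensity u * (gaussianCDF (-d - u) - gaussianCDF (β * (-d - u))) := by
  have hi : Integrable fun u =>
      gaussianDensity u * (gaussianCDF (-d - u) - gaussianCDF (β * (-d - u))) := by
    simp_rw [mul_sub]
    exact (integrable_density_mul_cdf (by fun_prop)).sub (integrable_density_mul_cdf (by fun_prop))
  have hc : Continuous fun u =>
      (1 - β) * gaussianDensity (2 * d) * ((-d - u) * gaussianDensity (-d - u)) := by
    have := continuous_gaussianDensity
    fun_prop
  have h1 : ∫ u in (-(2 * d))..(-d),
      (1 - β) * gaussianDensity (2 * d) * ((-d - u) * gaussianDensity (-d - u)) =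
      (1 - β) * gaussianDensity (2 * d) * (gaussianDensity 0 - gaussianDensity d) := by
    rw [intervalIntegral.integral_eq_sub_of_hasDerivAt
      (f := fun u => (1 - β) * gaussianDensity (2 * d) * gaussianDensity (-d - u))]
    · rw [show -d - -d = (0 : ℝ) by ring, show -d - -(2 * d) = d by ring]
      ring
    · intro u _
      have h2 : HasDerivAt (fun u : ℝ => -d - u) (-1) u := by
        simpa using (hasDerivAt_id u).const_sub (-d)
      convert! ((hasDerivAt_gaussianDensity (-d - u)).comp u h2).const_mul _ using 1
      ring
    · exact hc.intervalIntegrable _ _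
  rw [← h1, intervalIntegral.integral_of_le (by linarith)]
  have hnn : ∀ u ∈ Iic (-d),
      0 ≤ gaussianDensity u * (gaussianCDF (-d - u) - gaussianCDF (β * (-d - u))) := by
    intro u hu
    have hu' : 0 ≤ -d - u := by linarith [mem_Iic.1 hu]
    refine mul_nonneg (gaussianDensity_pos u).le ?_
    exact sub_nonneg.2 (gaussianCDF_strictMono.monotone (mul_le_of_le_one_left hu' hβ'))
  calc _ ≤ ∫ u in Ioc (-(2 * d)) (-d),
        gaussianDensity u * (gaussianCDF (-d - u) - gaussianCDF (β * (-d - u))) := by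
        refine setIntegral_mono_on (hc.integrableOn_Ioc) hi.integrableOn measurableSet_Ioc ?_
        intro u hu
        have hv : 0 ≤ -d - u := by linarith [hu.2]
        have h3 := le_gaussianCDF_sub hβ hβ' hv
        have h4 : gaussianDensity (2 * d) ≤ gaussianDensity u :=
          gaussianDensity_le_of_sq_le (by nlinarith [hu.1, hu.2])
        have h5 : 0 ≤ (1 - β) * (-d - u) * gaussianDensity (-d - u) :=
          mul_nonneg (mul_nonneg (by linarith) hv) (gaussianDensity_pos _).le
        calc _ = gaussianDensity (2 * d) * ((1 - β) * (-d - u) * gaussianDensity (-d - u)) := by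
              ring
          _ ≤ _ := mul_le_mul h4 h3 h5 (gaussianDensity_pos _).le
    _ ≤ _ := by
        refine setIntegral_mono_set hi.integrableOn ?_ Ioc_subset_Iic_self.eventuallyLE
        exact (ae_restrict_iff' measurableSet_Iic).2 (ae_of_all _ hnn)

/-- Switching to the larger variance exactly when the first half falls below the threshold lowers
the Gaussian error probability. -/
lemma prod_gaussian_switch_le {β d : ℝ} (hβ : 0 ≤ β) (hβ' : β ≤ 1) (hd : 0 ≤ d) :
    ((gaussianReal 0 1).prod (gaussianReal 0 1)).real
        {p | p.1 ∈ Iic (-d) ∧ p.2 ≤ β * (-d - p.1)} +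
      ((gaussianReal 0 1).prod (gaussianReal 0 1)).real {p | p.1 ∈ Ici (-d) ∧ p.2 ≤ -d - p.1} ≤
    gaussianCDF (-d / √2) -
      (1 - β) * gaussianDensity (2 * d) * (gaussianDensity 0 - gaussianDensity d) := by
  have hi := integrable_density_mul_cdf (g := fun u => -d - u) (by fun_prop)
  have hi' := integrable_density_mul_cdf (g := fun u => β * (-d - u)) (by fun_prop)
  have h0 : gaussianCDF (-d / √2) = ∫ u, gaussianDensity u * gaussianCDF (-d - u) := by
    rw [← prod_gaussian_add_le, ← setIntegral_univ, ← prod_gaussian_real .univ (by fun_prop)]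
    simp
  have h1 := intervalIntegral.integral_Iic_add_Ioi (b := -d) hi.integrableOn hi.integrableOn
  have h2 := switch_gain_integral hβ hβ' hd
  have h3 : ∫ u in Iic (-d),
      gaussianDensity u * (gaussianCDF (-d - u) - gaussianCDF (β * (-d - u))) =
      (∫ u in Iic (-d), gaussianDensity u * gaussianCDF (-d - u)) -
        ∫ u in Iic (-d), gaussianDensity u * gaussianCDF (β * (-d - u)) := by
    rw [← integral_sub hi.integrableOn hi'.integrableOn]
    exact integral_congr_ae (ae_of_all _ fun u => mul_sub _ _ _)
  rw [prod_gaussian_real (g := fun u => β * (-d - u)) measurableSet_Iic (by fun_prop),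
    prod_gaussian_real (g := fun u => -d - u) measurableSet_Ici (by fun_prop),
    integral_Ici_eq_integral_Ioi, h0, ← h1]
  linarith

lemma exists_coarse_gain {ε β : ℝ} (hε : 0 < ε) (hε' : ε < 1 / 2) (hβ : β < 1) :
    ∃ α : ℝ, 1 < α ∧ α < 1 / (2 * ε) ∧
      ε * (α - 1) - (1 - β) * gaussianDensity (2 * √2 * gaussianQuantile (α * ε))
        * (1 / √(2 * Real.pi) - gaussianDensity (√2 * gaussianQuantile (α * ε))) < 0 := by
  set p := (ε + 1 / 2) / 2 with hp
  have hεp : ε < p := by rw [hp]; linarith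
  have hp2 : p < 1 / 2 := by rw [hp]; linarith
  have hq := gaussianQuantile_neg (hε.trans hεp) hp2
  -- A lower bound for the gain, uniform for `αε` in `[ε, p]`: quantiles there are negative and
  -- increasing, so the first density is least at `ε` and the second greatest at `p`.
  set δ := (1 - β) * gaussianDensity (2 * √2 * gaussianQuantile ε)
    * (1 / √(2 * Real.pi) - gaussianDensity (√2 * gaussianQuantile p)) with hδ
  have hlt : gaussianDensity (√2 * gaussianQuantile p) < 1 / √(2 * Real.pi) := by
    rw [← gaussianDensity_zero]
    exact gaussianDensity_lt_zero (mul_ne_zero (by positivity) hq.ne)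
  have hδ0 : 0 < δ :=
    mul_pos (mul_pos (by linarith) (gaussianDensity_pos _)) (by linarith)
  -- `s` plays the role of `αε`; the cap `ε + δ / 2` keeps the loss `ε(α - 1) = s - ε` strictly
  -- below `δ`.
  set s := min p (ε + δ / 2) with hs
  have hεs : ε < s := lt_min hεp (by linarith)
  have hsp : s ≤ p := min_le_left _ _
  have e : s / ε * ε = s := div_mul_cancel₀ _ hε.ne'
  refine ⟨s / ε, (one_lt_div hε).2 hεs, ?_, ?_⟩
  · rw [div_lt_div_iff₀ hε (by positivity)]; nlinarith
  · have h1 : ε * (s / ε - 1) = s - ε := by field_simp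
    have h2 : s ≤ ε + δ / 2 := min_le_right _ _
    rw [e, h1]
    have hqs : gaussianQuantile s ≤ gaussianQuantile p := by
      rcases hsp.eq_or_lt with h | h
      · rw [h]
      · exact (gaussianQuantile_lt (hε.trans hεs) h (by linarith)).le
    have hqe := gaussianQuantile_lt hε hεs (by linarith)
    have h3 : gaussianDensity (√2 * gaussianQuantile s) ≤
        gaussianDensity (√2 * gaussianQuantile p) := by
      refine gaussianDensity_le_of_sq_le ?_
      rw [mul_pow, mul_pow]
      gcongr _ * ?_
      nlinarith
    have h4 : gaussianDensity (2 * √2 * gaussianQuantile ε) ≤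
        gaussianDensity (2 * √2 * gaussianQuantile s) := by
      refine gaussianDensity_le_of_sq_le ?_
      rw [mul_pow, mul_pow _ (gaussianQuantile ε)]
      gcongr _ * ?_
      nlinarith
    have h5 : δ ≤ (1 - β) * gaussianDensity (2 * √2 * gaussianQuantile s)
        * (1 / √(2 * Real.pi) - gaussianDensity (√2 * gaussianQuantile s)) := by
      have := gaussianDensity_pos (2 * √2 * gaussianQuantile s)
      have : 0 < 1 - β := by linarith
      rw [hδ]
      gcongr
    linarith

/-! ### Central limit theorem for finitely supported letters. -/

/-- The standard Gaussian law on `ℝ`. -/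
def stdGaussianLaw : ProbabilityMeasure ℝ := ⟨gaussianReal 0 1, inferInstance⟩

lemma coe_stdGaussianLaw : (stdGaussianLaw : Measure ℝ) = gaussianReal 0 1 := rfl

section Laws

variable {A : Type*} [Fintype A] [MeasurableSpace A]

/-- The measure on a finite type with point masses `w`. -/
def massMeasure (w : A → ℝ) : Measure A := ∑ a, ENNReal.ofReal (w a) • Measure.dirac a

lemma isProbabilityMeasure_massMeasure {w : A → ℝ} (hw : w ∈ stdSimplex ℝ A) :
    IsProbabilityMeasure (massMeasure w) := by
  refine ⟨?_⟩
  simp only [massMeasure, Measure.finsetSum_apply, Measure.smul_apply, measure_univ, smul_eq_mul,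
    mul_one]
  rw [← ENNReal.ofReal_sum_of_nonneg fun a _ => hw.1 a, hw.2, ENNReal.ofReal_one]

variable [MeasurableSingletonClass A]

lemma massMeasure_singleton (w : A → ℝ) (a : A) :
    massMeasure w {a} = ENNReal.ofReal (w a) := by
  classical
  simp [massMeasure, Measure.finsetSum_apply, Set.indicator_apply]

lemma integral_massMeasure {w : A → ℝ} (hw : w ∈ stdSimplex ℝ A) (f : A → ℝ) :
    ∫ a, f a ∂(massMeasure w) = ∑ a, w a * f a := by
  have := isProbabilityMeasure_massMeasure hw
  rw [integral_fintype .of_finite]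
  refine Finset.sum_congr rfl fun a _ => ?_
  rw [measureReal_def, massMeasure_singleton, ENNReal.toReal_ofReal (hw.1 a), smul_eq_mul]

lemma pi_massMeasure_real_singleton {w : A → ℝ} (hw : w ∈ stdSimplex ℝ A) {ι : Type*} [Fintype ι]
    (z : ι → A) : (Measure.pi fun _ : ι => massMeasure w).real {z} = ∏ k, w (z k) := by
  have := isProbabilityMeasure_massMeasure hw
  rw [measureReal_def, Measure.pi_singleton, ENNReal.toReal_prod]
  refine Finset.prod_congr rfl fun k _ => ?_
  rw [massMeasure_singleton, ENNReal.toReal_ofReal (hw.1 _)]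

/-- The law of `c * ∑ k, ξ (z k)` for independent `z k` with point masses `w`. -/
def sumLaw {w : A → ℝ} (hw : w ∈ stdSimplex ℝ A) (ι : Type*) [Fintype ι] (ξ : A → ℝ) (c : ℝ) :
    ProbabilityMeasure ℝ :=
  ⟨(Measure.pi fun _ : ι => massMeasure w).map fun z => c * ∑ k, ξ (z k), by
    have := isProbabilityMeasure_massMeasure hw
    exact Measure.isProbabilityMeasure_map (measurable_of_finite _).aemeasurable⟩

lemma coe_sumLaw {w : A → ℝ} (hw : w ∈ stdSimplex ℝ A) (ι : Type*) [Fintype ι] (ξ : A → ℝ)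
    (c : ℝ) : (sumLaw hw ι ξ c : Measure ℝ) =
      (Measure.pi fun _ : ι => massMeasure w).map fun z => c * ∑ k, ξ (z k) := rfl

lemma charFun_sumLaw {w : A → ℝ} (hw : w ∈ stdSimplex ℝ A) (ι : Type*) [Fintype ι] (ξ : A → ℝ)
    (c t : ℝ) : charFun (sumLaw hw ι ξ c : Measure ℝ) t =
      charFun ((massMeasure w).map ξ) (c * t) ^ Fintype.card ι := by
  have := isProbabilityMeasure_massMeasure hw
  have hind : iIndepFun (fun (k : ι) (z : ι → A) => ξ (z k))
      (Measure.pi fun _ : ι => massMeasure w) :=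
    iIndepFun_pi (X := fun _ => ξ) fun _ => (measurable_of_finite _).aemeasurable
  rw [coe_sumLaw, charFun_map_mul_comp (measurable_of_finite _).aemeasurable,
    (hind.restrict _).charFun_map_fun_finsetSum_eq_prod
      fun _ _ => (measurable_of_finite _).aemeasurable]
  have h (k : ι) : (Measure.pi fun _ : ι => massMeasure w).map (fun z => ξ (z k)) =
      (massMeasure w).map ξ := by
    rw [← Function.comp_def ξ, ← Measure.map_map (g := ξ) (f := fun z : ι → A => z k)
      (measurable_of_finite _) (measurable_of_finite _)]
    exact congrArg _ (measurePreserving_eval (fun _ : ι => massMeasure w) k).map_eq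
  simp [h]

lemma tendsto_sumLaw_standard {w : A → ℝ} (hw : w ∈ stdSimplex ℝ A) {ξ : A → ℝ}
    (h0 : ∑ a, w a * ξ a = 0) (h1 : ∑ a, w a * ξ a ^ 2 = 1) (ι : ℕ → Type*)
    [∀ n, Fintype (ι n)] (hι : Tendsto (fun n => Fintype.card (ι n)) atTop atTop) :
    Tendsto (fun n => sumLaw hw (ι n) ξ (√(Fintype.card (ι n) : ℝ))⁻¹) atTop
      (𝓝 stdGaussianLaw) := by
  have := isProbabilityMeasure_massMeasure hw
  refine ProbabilityMeasure.tendsto_iff_tendsto_charFun.2 fun t => ?_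
  simp_rw [charFun_sumLaw]
  have h := tendsto_charFun_inv_sqrt_mul_pow (P := massMeasure w) (X := ξ)
    (measurable_of_finite _).aemeasurable (by rw [integral_massMeasure hw, h0])
    (by simp only [Pi.pow_apply]; rw [integral_massMeasure hw, h1]) t
  simpa [coe_stdGaussianLaw, charFun_gaussianReal, neg_div, Function.comp_def] using h.comp hι

/-- The block has about `κn` letters but is normalized by `√n`, so the standardized sum is
multiplied by the deterministic scale `√(v · card / n)`, which tends to `√(vκ)`. This Slutsky step
pairs the law with a Dirac mass at the scale and uses continuity of products and of images under
multiplication. -/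
lemma tendsto_sumLaw {w : A → ℝ} (hw : w ∈ stdSimplex ℝ A) {ξ : A → ℝ} {v κ : ℝ} (hv : 0 < v)
    (hκ : 0 < κ) (h0 : ∑ a, w a * ξ a = 0) (h1 : ∑ a, w a * ξ a ^ 2 = v) (ι : ℕ → Type*)
    [∀ n, Fintype (ι n)]
    (hι : Tendsto (fun n : ℕ => (Fintype.card (ι n) : ℝ) / n) atTop (𝓝 κ)) :
    Tendsto (fun n : ℕ => sumLaw hw (ι n) ξ (√(n : ℝ))⁻¹) atTop
      (𝓝 (stdGaussianLaw.map (f := fun u => √(v * κ) * u) (by fun_prop))) := by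
  have hcard : Tendsto (fun n => Fintype.card (ι n)) atTop atTop := by
    have h2 : Tendsto (fun n : ℕ => (Fintype.card (ι n) : ℝ) / n * n) atTop atTop :=
      hι.pos_mul_atTop hκ tendsto_natCast_atTop_atTop
    have h3 : Tendsto (fun n : ℕ => (Fintype.card (ι n) : ℝ)) atTop atTop := by
      refine h2.congr' ?_
      filter_upwards [eventually_gt_atTop 0] with n hn
      have : (n : ℝ) ≠ 0 := by positivity
      field_simp
    exact tendsto_natCast_atTop_iff.1 h3
  have hs : √v ≠ 0 := by positivity
  have hstd := tendsto_sumLaw_standard hw (ξ := fun a => ξ a / √v)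
    (by simp_rw [← mul_div_assoc, ← Finset.sum_div, h0, zero_div])
    (by simp_rw [div_pow, Real.sq_sqrt hv.le, ← mul_div_assoc, ← Finset.sum_div, h1]
        exact div_self hv.ne') ι hcard
  have hscale : Tendsto (fun n : ℕ => √(v * ((Fintype.card (ι n) : ℝ) / n))) atTop
      (𝓝 √(v * κ)) := (hι.const_mul v).sqrt
  have hpair := (ProbabilityMeasure.continuous_map
    (f := fun p : ℝ × ℝ => p.2 * p.1) (by fun_prop)).continuousAt.tendsto.comp
      ((ProbabilityMeasure.continuous_prod (α := ℝ) (β := ℝ)).continuousAt.tendsto.comp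
        (hstd.prodMk_nhds (continuous_diracProba.continuousAt.tendsto.comp hscale)))
  have hprod : ∀ (μ : ProbabilityMeasure ℝ) (s : ℝ),
      (μ.prod (diracProba s)).map (f := fun p : ℝ × ℝ => p.2 * p.1) (by fun_prop) =
        μ.map (f := fun u => s * u) (by fun_prop) := by
    intro μ s
    apply Subtype.ext
    have hd : ((diracProba s : ProbabilityMeasure ℝ) : Measure ℝ) = Measure.dirac s := rfl
    simp only [ProbabilityMeasure.toMeasure_map, ProbabilityMeasure.toMeasure_prod,
      ProbabilityMeasure.val_eq_to_measure]
    rw [hd, Measure.prod_dirac, Measure.map_map (by fun_prop) (by fun_prop)]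
    rfl
  simp only [Function.comp_def] at hpair
  rw [hprod] at hpair
  refine hpair.congr' ?_
  filter_upwards [eventually_gt_atTop 0, hcard.eventually_gt_atTop 0] with n hn hc
  rw [hprod]
  apply Subtype.ext
  have := isProbabilityMeasure_massMeasure hw
  simp only [ProbabilityMeasure.toMeasure_map, ProbabilityMeasure.val_eq_to_measure]
  rw [coe_sumLaw, coe_sumLaw]
  rw [Measure.map_map (by fun_prop) (measurable_of_finite _)]
  congr 1
  funext z
  have hc' : (0 : ℝ) < Fintype.card (ι n) := by exact_mod_cast hc
  have hn' : (0 : ℝ) < n := by exact_mod_cast hn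
  simp only [Function.comp_apply]
  rw [Real.sqrt_mul hv.le, Real.sqrt_div hc'.le, ← Finset.sum_div]
  have : √(Fintype.card (ι n) : ℝ) ≠ 0 := by positivity
  have : √(n : ℝ) ≠ 0 := by positivity
  field_simp

open Classical in
lemma prod_sumLaw_real {w w' : A → ℝ} (hw : w ∈ stdSimplex ℝ A) (hw' : w' ∈ stdSimplex ℝ A)
    (ι ι' : Type*) [Fintype ι] [Fintype ι'] [DecidableEq ι] [DecidableEq ι'] (ξ : A → ℝ) (c : ℝ) {F : Set (ℝ × ℝ)}
    (hF : MeasurableSet F) :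
    (((sumLaw hw ι ξ c).prod (sumLaw hw' ι' ξ c) : ProbabilityMeasure (ℝ × ℝ)) :
      Measure (ℝ × ℝ)).real F =
    ∑ z : ι → A, ∑ z' : ι' → A, (∏ k, w (z k)) * (∏ k, w' (z' k)) *
      if (c * ∑ k, ξ (z k), c * ∑ k, ξ (z' k)) ∈ F then 1 else 0 := by
  have := isProbabilityMeasure_massMeasure hw
  have := isProbabilityMeasure_massMeasure hw'
  simp only [ProbabilityMeasure.toMeasure_prod]
  rw [coe_sumLaw, coe_sumLaw, Measure.map_prod_map _ _ (measurable_of_finite _) (measurable_of_finite _),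
    map_measureReal_apply (measurable_of_finite _) hF, ← integral_indicator_one
      (measurable_of_finite (Prod.map (fun z : ι → A => c * ∑ k, ξ (z k))
        (fun z : ι' → A => c * ∑ k, ξ (z k))) hF), integral_fintype .of_finite,
      Fintype.sum_prod_type]
  refine Finset.sum_congr rfl fun z _ => Finset.sum_congr rfl fun z' _ => ?_
  rw [← singleton_prod_singleton, measureReal_prod_prod, pi_massMeasure_real_singleton hw,
    pi_massMeasure_real_singleton hw', smul_eq_mul]
  congr 1

end Laws

open Classical in
/-- A two-block central limit theorem for closed sets and finitely supported summands. -/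
lemma eventually_two_block_sum_le {A : Type*} [Fintype A] {w w' : A → ℝ}
    (hw : w ∈ stdSimplex ℝ A) (hw' : w' ∈ stdSimplex ℝ A) {ξ : A → ℝ} {v v' κ κ' : ℝ}
    (hv : 0 < v) (hv' : 0 < v') (hκ : 0 < κ) (hκ' : 0 < κ')
    (h0 : ∑ a, w a * ξ a = 0) (h0' : ∑ a, w' a * ξ a = 0)
    (h1 : ∑ a, w a * ξ a ^ 2 = v) (h1' : ∑ a, w' a * ξ a ^ 2 = v')
    (ι ι' : ℕ → Type) [∀ n, Fintype (ι n)] [∀ n, Fintype (ι' n)]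
    [∀ n, DecidableEq (ι n)] [∀ n, DecidableEq (ι' n)]
    (hι : Tendsto (fun n : ℕ => (Fintype.card (ι n) : ℝ) / n) atTop (𝓝 κ))
    (hι' : Tendsto (fun n : ℕ => (Fintype.card (ι' n) : ℝ) / n) atTop (𝓝 κ'))
    {F : Set (ℝ × ℝ)} (hF : IsClosed F) {b : ℝ}
    (hb : ((gaussianReal 0 1).prod (gaussianReal 0 1)).real
      {p | (√(v * κ) * p.1, √(v' * κ') * p.2) ∈ F} < b) :
    ∀ᶠ n : ℕ in atTop, ∑ z : ι n → A, ∑ z' : ι' n → A, (∏ k, w (z k)) * (∏ k, w' (z' k)) *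
      (if ((√(n : ℝ))⁻¹ * ∑ k, ξ (z k), (√(n : ℝ))⁻¹ * ∑ k, ξ (z' k)) ∈ F then 1 else 0) < b := by
  let : MeasurableSpace A := ⊤
  have : MeasurableSingletonClass A := ⟨fun _ => trivial⟩
  have hlim := (ProbabilityMeasure.continuous_prod (α := ℝ) (β := ℝ)).continuousAt.tendsto.comp
    ((tendsto_sumLaw hw hv hκ h0 h1 ι hι).prodMk_nhds (tendsto_sumLaw hw' hv' hκ' h0' h1' ι' hι'))
  -- Only upper bounds on error probabilities are needed, so the closed-set half of the portmanteau
  -- theorem suffices and no boundary has to be shown null.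
  have hsup := ProbabilityMeasure.limsup_measure_closed_le_of_tendsto hlim hF
  have hlt : limsup (fun n : ℕ => (((sumLaw hw (ι n) ξ (√(n : ℝ))⁻¹).prod
      (sumLaw hw' (ι' n) ξ (√(n : ℝ))⁻¹) : ProbabilityMeasure (ℝ × ℝ)) : Measure (ℝ × ℝ)) F) atTop
      < ENNReal.ofReal b := by
    refine lt_of_le_of_lt hsup ?_
    simp only [ProbabilityMeasure.toMeasure_prod, ProbabilityMeasure.toMeasure_map,
      coe_stdGaussianLaw]
    rw [Measure.map_prod_map _ _ (by fun_prop) (by fun_prop),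
      Measure.map_apply (by fun_prop) hF.measurableSet, ← ofReal_measureReal,
      ENNReal.ofReal_lt_ofReal_iff_of_nonneg measureReal_nonneg]
    exact hb
  filter_upwards [eventually_lt_of_limsup_lt hlt] with n hn
  rw [← prod_sumLaw_real hw hw' (ι n) (ι' n) ξ _ hF.measurableSet]
  rw [← ofReal_measureReal, ENNReal.ofReal_lt_ofReal_iff_of_nonneg measureReal_nonneg] at hn
  exact hn

/-! ### Capacity-achieving input distributions and their information densities. -/

namespace Channel

variable {X Y : Type*} [Fintype X] [Fintype Y] [Nonempty X]

lemma qStar_eq_outDist (W : Channel X Y) {P : X → ℝ} (hP : P ∈ W.capAchieving) :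
    W.qStar = W.outDist P := funext fun y => W.qStar_eq hP y

lemma qStar_pos (W : Channel X Y) {P : X → ℝ} (hP : P ∈ W.capAchieving) {x : X} {y : Y}
    (hx : 0 < P x) (hy : 0 < W.prob x y) : 0 < W.qStar y := by
  rw [W.qStar_eq hP]
  exact (mul_pos hx hy).trans_le (Finset.single_le_sum (f := fun x => P x * W.prob x y)
    (fun i _ => mul_nonneg (hP.1.1 i) (W.prob_nonneg i y)) (Finset.mem_univ x))

lemma sum_qStar (W : Channel X Y) : ∑ y, W.qStar y = 1 := by
  obtain ⟨P, hP⟩ := W.capAchieving_nonempty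
  simp_rw [W.qStar_eq hP]
  rw [Finset.sum_comm]
  simp_rw [← Finset.mul_sum, W.prob_sum, mul_one]
  exact hP.1.2

/-- Every input letter used by a capacity-achieving distribution has relative entropy `C` from
the output distribution. -/
lemma sum_prob_mul_infoDensity (W : Channel X Y) {P : X → ℝ} (hP : P ∈ W.capAchieving) {x : X}
    (hx : 0 < P x) : ∑ y, W.prob x y * W.infoDensity x y = W.capacity := by
  classical
  set q := W.qStar with hq
  set H : X → ℝ := fun x => ∑ y, Real.negMulLog (W.prob x y) with hH
  set A := ∑ x', P x' * H x' with hA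
  have hWq : ∀ y, q y = 0 → W.prob x y = 0 := by
    intro y hy
    by_contra h
    have := W.qStar_pos hP hx (lt_of_le_of_ne (W.prob_nonneg x y) (Ne.symm h))
    exact this.ne' hy
  set R : ℝ → X → ℝ := fun t x' => (1 - t) * P x' + t * (if x' = x then 1 else 0) with hR
  have hx1 : P x ≤ 1 := by
    rw [← hP.1.2]
    exact Finset.single_le_sum (fun i _ => hP.1.1 i) (Finset.mem_univ x)
  have hRs : ∀ t, |t| < P x → R t ∈ stdSimplex ℝ X := by
    intro t ht
    rw [abs_lt] at ht
    refine ⟨fun x' => ?_, ?_⟩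
    · simp only [hR]
      have h1 := hP.1.1 x'
      split_ifs with h
      · subst h; nlinarith
      · nlinarith
    · simp only [hR, Finset.sum_add_distrib, ← Finset.mul_sum, hP.1.2]
      simp
  have hRout : ∀ t y, W.outDist (R t) y = q y + t * (W.prob x y - q y) := by
    intro t y
    simp only [outDist, hR, add_mul, Finset.sum_add_distrib, mul_assoc, ← Finset.mul_sum]
    rw [← W.qStar_eq hP]
    simp only [ite_mul, one_mul, zero_mul, Finset.sum_ite_eq', Finset.mem_univ, if_true]
    ring
  have hRH : ∀ t, ∑ x', R t x' * H x' = A + t * (H x - A) := by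
    intro t
    simp only [hR, add_mul, Finset.sum_add_distrib, mul_assoc, ← Finset.mul_sum]
    simp only [ite_mul, one_mul, zero_mul, Finset.sum_ite_eq', Finset.mem_univ, if_true]
    ring
  set φ : ℝ → ℝ := fun t => ∑ y, Real.negMulLog (q y + t * (W.prob x y - q y))
    - (A + t * (H x - A)) with hφ
  have hφI : ∀ t, |t| < P x → φ t = W.mutualInfo (R t) := by
    intro t ht
    rw [W.mutualInfo_eq (hRs t ht)]
    simp only [hRout]
    rw [hRH]
  have hφ0 : φ 0 = W.capacity := by
    rw [← hP.2, W.mutualInfo_eq hP.1, ← W.qStar_eq_outDist hP]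
    simp [hφ, hA, hH, hq]
  have hmax : IsLocalMax φ 0 := by
    have : ∀ᶠ t in 𝓝 (0 : ℝ), |t| < P x := by
      have h := (continuous_abs (G := ℝ)).tendsto 0
      rw [abs_zero] at h
      exact h.eventually_lt_const hx
    filter_upwards [this] with t ht
    rw [hφI t ht, hφ0]
    exact W.mutualInfo_le_capacity (hRs t ht)
  have hder : HasDerivAt φ (∑ y, (-Real.log (q y) - 1) * (W.prob x y - q y) - (H x - A)) 0 := by
    refine HasDerivAt.sub (HasDerivAt.fun_sum fun y _ => ?_) ?_
    · have hl : HasDerivAt (fun t : ℝ => q y + t * (W.prob x y - q y)) (W.prob x y - q y) 0 := by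
        simpa using ((hasDerivAt_id (0 : ℝ)).mul_const (W.prob x y - q y)).const_add (q y)
      -- `negMulLog` is not differentiable at `0`, but `q y = 0` forces `W(y|x) = 0`, so that term
      -- is constant in `t`.
      by_cases hy : q y = 0
      · simp only [hy, hWq y hy]
        simpa using hasDerivAt_const (0 : ℝ) (0 : ℝ)
      · have h1 : HasDerivAt Real.negMulLog (-Real.log (q y) - 1)
            (q y + 0 * (W.prob x y - q y)) := by
          rw [zero_mul, add_zero]
          exact Real.hasDerivAt_negMulLog hy
        exact h1.comp (0 : ℝ) hl
    · simpa using ((hasDerivAt_id (0 : ℝ)).mul_const (H x - A)).const_add A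
  have h0 := hmax.hasDerivAt_eq_zero hder
  have hC : W.capacity = ∑ y, Real.negMulLog (q y) - A := by
    rw [← hφ0]; simp [hφ]
  have hterm : ∀ y, W.prob x y * W.infoDensity x y =
      -Real.negMulLog (W.prob x y) - Real.log (q y) * W.prob x y := by
    intro y
    by_cases hw : W.prob x y = 0
    · simp [hw]
    · have hy : q y ≠ 0 := fun h => hw (hWq y h)
      rw [infoDensity, Real.log_div hw hy, Real.negMulLog]
      ring
  have hsplit : ∀ y, (-Real.log (q y) - 1) * (W.prob x y - q y) =
      -(Real.log (q y) * W.prob x y) - Real.negMulLog (q y) - W.prob x y + q y := by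
    intro y; rw [Real.negMulLog]; ring
  simp_rw [hsplit, Finset.sum_add_distrib, Finset.sum_sub_distrib, W.prob_sum, hq,
    W.sum_qStar] at h0
  rw [← hq] at h0
  simp_rw [hterm, Finset.sum_sub_distrib]
  rw [Finset.sum_neg_distrib, hC]
  rw [Finset.sum_neg_distrib] at h0
  simp only [hH] at h0
  linarith

/-- The joint law of input and output when the input has law `P`. -/
def jointLaw (W : Channel X Y) (P : X → ℝ) (z : X × Y) : ℝ := P z.1 * W.prob z.1 z.2

/-- The information density centered at capacity. -/
def centeredDensity (W : Channel X Y) (z : X × Y) : ℝ := W.infoDensity z.1 z.2 - W.capacity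

omit [Nonempty X] in
lemma jointLaw_mem (W : Channel X Y) {P : X → ℝ} (hP : P ∈ stdSimplex ℝ X) :
    W.jointLaw P ∈ stdSimplex ℝ (X × Y) := by
  refine ⟨fun z => mul_nonneg (hP.1 _) (W.prob_nonneg _ _), ?_⟩
  simp only [jointLaw, Fintype.sum_prod_type, ← Finset.mul_sum, W.prob_sum, mul_one]
  exact hP.2

lemma sum_jointLaw_mul_centeredDensity (W : Channel X Y) {P : X → ℝ} (hP : P ∈ W.capAchieving) :
    ∑ z, W.jointLaw P z * W.centeredDensity z = 0 := by
  simp only [jointLaw, centeredDensity, Fintype.sum_prod_type, mul_assoc, ← Finset.mul_sum,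
    mul_sub, Finset.sum_sub_distrib]
  simp only [← Finset.sum_mul, W.prob_sum, one_mul]
  rw [Finset.sum_mul, ← Finset.sum_sub_distrib]
  refine Finset.sum_eq_zero fun x _ => ?_
  rcases (hP.1.1 x).eq_or_lt with h | h
  · simp [← h]
  · rw [W.sum_prob_mul_infoDensity hP h, sub_self]

/-- All used letters have the same conditional mean `C`, so the unconditional variance has no
between-letter part and equals the averaged conditional variance. -/
lemma sum_jointLaw_mul_centeredDensity_sq (W : Channel X Y) {P : X → ℝ}
    (hP : P ∈ W.capAchieving) :
    ∑ z, W.jointLaw P z * W.centeredDensity z ^ 2 = W.dispersion P := by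
  simp only [jointLaw, centeredDensity, Fintype.sum_prod_type, mul_assoc, ← Finset.mul_sum,
    dispersion, condVar]
  refine Finset.sum_congr rfl fun x _ => ?_
  rcases (hP.1.1 x).eq_or_lt with h | h
  · simp [← h]
  · rw [W.sum_prob_mul_infoDensity hP h]

-- The entropy formula for mutual information is continuous on the whole space and agrees with it on
-- the simplex, so the maximizers form a closed subset of a compact set.
omit [Nonempty X] in
lemma isCompact_capAchieving (W : Channel X Y) : IsCompact W.capAchieving := by
  have hc : Continuous fun P : X → ℝ => ∑ y, Real.negMulLog (W.outDist P y)
      - ∑ x, P x * ∑ y, Real.negMulLog (W.prob x y) := by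
    unfold outDist
    have := Real.continuous_negMulLog
    fun_prop
  have : W.capAchieving = stdSimplex ℝ X ∩ {P | ∑ y, Real.negMulLog (W.outDist P y)
      - ∑ x, P x * ∑ y, Real.negMulLog (W.prob x y) = W.capacity} := by
    ext P
    constructor
    · exact fun h => ⟨h.1, (W.mutualInfo_eq h.1).symm.trans h.2⟩
    · exact fun h => ⟨h.1, (W.mutualInfo_eq h.1).trans h.2⟩
  rw [this]
  exact (isCompact_stdSimplex ℝ X).inter_right (isClosed_eq hc continuous_const)

lemma isCompact_image_dispersion (W : Channel X Y) :
    IsCompact (W.dispersion '' W.capAchieving) := by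
  refine W.isCompact_capAchieving.image ?_
  unfold dispersion
  fun_prop

lemma exists_dispersion_eq_Vmin (W : Channel X Y) :
    ∃ P ∈ W.capAchieving, W.dispersion P = W.Vmin :=
  W.isCompact_image_dispersion.sInf_mem (W.capAchieving_nonempty.image _)

lemma exists_dispersion_eq_Vmax (W : Channel X Y) :
    ∃ P ∈ W.capAchieving, W.dispersion P = W.Vmax :=
  W.isCompact_image_dispersion.sSup_mem (W.capAchieving_nonempty.image _)

lemma Vmin_le_Vmax (W : Channel X Y) : W.Vmin ≤ W.Vmax :=
  csInf_le_csSup (W.capAchieving_nonempty.image _) W.isCompact_image_dispersion.bddBelow W.isCompact_image_dispersion.bddAbove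

end Channel

/-! ### Random coding with a threshold decoder. -/

section RandomCoding

variable {Ω B : Type*} [Fintype Ω] [Fintype B]

lemma sum_pi_prod {ι : Type*} [Fintype ι] [DecidableEq ι] (h : ι → Ω → ℝ) :
    ∑ w : ι → Ω, ∏ j, h j (w j) = ∏ j, ∑ ω, h j ω := by
  rw [Finset.prod_univ_sum, Fintype.piFinset_univ]

lemma sum_pi_prod_mul {ι : Type*} [Fintype ι] [DecidableEq ι] {p : Ω → ℝ} (hp : ∑ ω, p ω = 1) (f : Ω → ℝ)
    (m : ι) : ∑ w : ι → Ω, (∏ j, p (w j)) * f (w m) = ∑ ω, p ω * f ω := by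
  have h := sum_pi_prod fun (j : ι) ω => p ω * if j = m then f ω else 1
  simp only [Finset.prod_mul_distrib, Finset.prod_ite_eq', Finset.mem_univ, if_true] at h
  rw [h, Finset.prod_eq_single m]
  · simp
  · intro j _ hj; simp [hj, hp]
  · simp

/-- Pairwise independence of the sent codeword and a competing one: all other coordinates sum out to
one. -/
lemma sum_pi_prod_mul_mul {ι : Type*} [Fintype ι] [DecidableEq ι] {p : Ω → ℝ} (hp : ∑ ω, p ω = 1)
    (f g : Ω → ℝ) {m m' : ι} (hm : m ≠ m') :
    ∑ w : ι → Ω, (∏ j, p (w j)) * (f (w m) * g (w m')) =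
      (∑ ω, p ω * f ω) * ∑ ω, p ω * g ω := by
  have h := sum_pi_prod fun (j : ι) ω =>
    p ω * ((if j = m then f ω else 1) * if j = m' then g ω else 1)
  simp only [Finset.prod_mul_distrib, Finset.prod_ite_eq', Finset.mem_univ, if_true] at h
  rw [h, Finset.prod_eq_mul m m' hm]
  · simp [hm, hm.symm]
  · intro j _ hj; simp [hj.1, hj.2, hp]
  · simp
  · simp

omit [Fintype B] in
open Classical in
/-- A threshold decoder: it selects a message whose likelihood exceeds the threshold, if any. -/
lemma exists_threshold_decoder {M : ℕ} (hM : 0 < M) (L : Fin M → B → ℝ) (hL : ∀ m y, 0 ≤ L m y)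
    (τ : B → ℝ) :
    ∃ g : B → Fin M, ∀ m y, (if g y ≠ m then L m y else 0) ≤
      (if L m y ≤ τ y then L m y else 0) +
        ∑ m' ∈ Finset.univ.erase m, L m y * if τ y < L m' y then 1 else 0 := by
  refine ⟨fun y => if h : ∃ m, τ y < L m y then h.choose else ⟨0, hM⟩, fun m y => ?_⟩
  have hnn : ∀ m', 0 ≤ L m y * if τ y < L m' y then 1 else 0 := fun m' =>
    mul_nonneg (hL m y) (by split_ifs <;> norm_num)
  have hsum : 0 ≤ ∑ m' ∈ Finset.univ.erase m, L m y * if τ y < L m' y then 1 else 0 :=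
    Finset.sum_nonneg fun m' _ => hnn m'
  by_cases hgood : L m y ≤ τ y
  · rw [if_pos hgood]
    split_ifs
    · linarith
    · linarith [hL m y]
  -- The true message passes the threshold, so the decoder picks some passing message; an error
  -- means that this is another message, which the union bound counts.
  · rw [if_neg hgood, zero_add]
    have hex : ∃ m, τ y < L m y := ⟨m, not_le.1 hgood⟩
    simp only [dif_pos hex]
    split_ifs with hne
    · have := Finset.single_le_sum
        (f := fun m' => L m y * if τ y < L m' y then 1 else 0) (fun m' _ => hnn m')
        (Finset.mem_erase.2 ⟨hne, Finset.mem_univ hex.choose⟩)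
      simpa [hex.choose_spec] using this
    · exact hsum

open Classical in
/-- The random coding bound for independent codewords `w m` with law `p`, likelihoods `L` and
output law `q`. -/
lemma random_coding_bound {M : ℕ} (hM : 0 < M) {p : Ω → ℝ} (hp : p ∈ stdSimplex ℝ Ω)
    {L : Ω → B → ℝ} (hL : ∀ ω y, 0 ≤ L ω y) {q : B → ℝ} (hq : ∑ y, q y = 1)
    (hpL : ∀ y, ∑ ω, p ω * L ω y = q y) {K : ℝ} (hK : 0 < K) :
    ∑ w : Fin M → Ω, (∏ m, p (w m)) * (⨅ g : B → Fin M,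
        (1 / (M : ℝ)) * ∑ m, ∑ y, if g y ≠ m then L (w m) y else 0) ≤
      (∑ y, ∑ ω, p ω * if L ω y ≤ K * q y then L ω y else 0) + (M - 1) / K := by
  have hM' : (0 : ℝ) < M := by exact_mod_cast hM
  have h1 : ∀ w : Fin M → Ω, (⨅ g : B → Fin M,
      (1 / (M : ℝ)) * ∑ m, ∑ y, if g y ≠ m then L (w m) y else 0) ≤
      (1 / (M : ℝ)) * ∑ m, ∑ y, ((if L (w m) y ≤ K * q y then L (w m) y else 0) +
        ∑ m' ∈ Finset.univ.erase m, L (w m) y * if K * q y < L (w m') y then 1 else 0) := by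
    intro w
    obtain ⟨g, hg⟩ := exists_threshold_decoder hM (fun m => L (w m)) (fun m => hL (w m))
      (fun y => K * q y)
    refine (ciInf_le (Set.finite_range _).bddBelow g).trans ?_
    gcongr with m _ y _
    exact hg m y
  -- Markov's inequality for an independent codeword. Keeping the factor `q y` on both sides covers
  -- the outputs with `q y = 0`.
  have h2 : ∀ y, (∑ ω, p ω * L ω y) * (∑ ω, p ω * if K * q y < L ω y then 1 else 0) ≤
      q y / K := by
    intro y
    rw [hpL, le_div_iff₀ hK, ← hpL, hpL, mul_assoc, mul_comm, Finset.sum_mul, Finset.sum_mul]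
    conv_rhs => rw [← hpL]
    refine Finset.sum_le_sum fun ω _ => ?_
    have := hp.1 ω
    rw [mul_assoc, mul_assoc]
    gcongr
    split_ifs with h
    · linarith
    · simpa using hL ω y
  calc _ ≤ ∑ w : Fin M → Ω, (∏ m, p (w m)) * ((1 / (M : ℝ)) * ∑ m, ∑ y,
        ((if L (w m) y ≤ K * q y then L (w m) y else 0) +
        ∑ m' ∈ Finset.univ.erase m, L (w m) y * if K * q y < L (w m') y then 1 else 0)) := by
        gcongr with w _
        · exact Finset.prod_nonneg fun m _ => hp.1 _
        · exact h1 w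
    _ = (1 / (M : ℝ)) * ∑ m : Fin M, ∑ y,
        ((∑ w : Fin M → Ω, (∏ j, p (w j)) * if L (w m) y ≤ K * q y then L (w m) y else 0) +
        ∑ m' ∈ Finset.univ.erase m, ∑ w : Fin M → Ω, (∏ j, p (w j)) *
          (L (w m) y * if K * q y < L (w m') y then 1 else 0)) := by
        simp_rw [mul_left_comm _ (1 / (M : ℝ)), ← Finset.mul_sum]
        congr 1
        simp_rw [Finset.mul_sum]
        rw [Finset.sum_comm]
        refine Finset.sum_congr rfl fun m _ => ?_
        rw [Finset.sum_comm]
        refine Finset.sum_congr rfl fun y _ => ?_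
        simp_rw [mul_add, Finset.sum_add_distrib, Finset.mul_sum]
        congr 1
        exact Finset.sum_comm
    _ = (1 / (M : ℝ)) * ∑ m : Fin M, ∑ y,
        ((∑ ω, p ω * if L ω y ≤ K * q y then L ω y else 0) +
        ∑ m' ∈ Finset.univ.erase m,
          (∑ ω, p ω * L ω y) * ∑ ω, p ω * if K * q y < L ω y then 1 else 0) := by
        congr 1
        refine Finset.sum_congr rfl fun m _ => Finset.sum_congr rfl fun y _ => ?_
        congr 1
        · exact sum_pi_prod_mul hp.2 (fun ω => if L ω y ≤ K * q y then L ω y else 0) m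
        · refine Finset.sum_congr rfl fun m' hm' => ?_
          exact sum_pi_prod_mul_mul hp.2 (fun ω => L ω y)
            (fun ω => if K * q y < L ω y then 1 else 0) (Finset.ne_of_mem_erase hm').symm
    _ ≤ (1 / (M : ℝ)) * ∑ m : Fin M, ∑ y,
        ((∑ ω, p ω * if L ω y ≤ K * q y then L ω y else 0) +
        ∑ m' ∈ (Finset.univ : Finset (Fin M)).erase m, q y / K) := by
        gcongr with m _ y _ m' _
        exact h2 y
    _ = _ := by
        simp only [Finset.sum_const, Finset.card_erase_of_mem (Finset.mem_univ _),
          Finset.card_univ, Fintype.card_fin, nsmul_eq_mul, Finset.sum_add_distrib,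
          ← Finset.mul_sum, ← Finset.sum_div, hq, Nat.cast_pred hM]
        field_simp

end RandomCoding

/-! ### The one-switch ensemble and its reduction to two independent blocks. -/

section Switching

variable {X Y ι : Type*} [Fintype X] [Fintype Y] [Fintype ι] [DecidableEq ι]

open Classical in
/-- Averaging over the two words of a message: the symbols actually sent have law `P` on the first
block, and law `Q` or `P` on the second block according to the condition `c` on the first block. -/
lemma sum_switch_words {P Q : X → ℝ} (hP : P ∈ stdSimplex ℝ X) (hQ : Q ∈ stdSimplex ℝ X)
    (p : ι → Prop) [DecidablePred p] (c : ({k // p k} → X) → Prop) (Θ : (ι → X) → ℝ) :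
    ∑ u : ι → X, ∑ v : ι → X, (∏ k, P (u k)) * (∏ k, Q (v k)) *
        Θ (fun k => if p k then u k else if c (fun k => u k) then v k else u k) =
      ∑ a : {k // p k} → X, ∑ b : {k // ¬p k} → X, (∏ k, P (a k)) *
        (∏ k, (if c a then Q else P) (b k)) *
        Θ ((Equiv.piEquivPiSubtypeProd p fun _ => X).symm (a, b)) := by
  set e := Equiv.piEquivPiSubtypeProd p fun _ => X with he
  have h1 : ∀ (R : X → ℝ) (a : {k // p k} → X) (b : {k // ¬p k} → X),
      ∏ k, R (e.symm (a, b) k) = (∏ k, R (a k)) * ∏ k, R (b k) := by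
    intro R a b
    rw [← Fintype.prod_subtype_mul_prod_subtype p]
    congr 1
    · refine Finset.prod_congr rfl fun k _ => ?_
      simp [he, k.2]
    · refine Finset.prod_congr rfl fun k _ => ?_
      simp [he, k.2]
  have h2 : ∀ (a a' : {k // p k} → X) (b b' : {k // ¬p k} → X),
      (fun k => if p k then e.symm (a, b) k else
        if c (fun k => e.symm (a, b) k) then e.symm (a', b') k else e.symm (a, b) k) =
      e.symm (a, if c a then b' else b) := by
    intro a a' b b'
    have h3 : (fun k : {k // p k} => e.symm (a, b) k) = a := by
      funext k; simp [he, k.2]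
    rw [h3]
    funext k
    by_cases hk : p k
    · simp [he, hk]
    · by_cases hc : c a <;> simp [he, hk, hc]
  have h3 : ∀ {R : X → ℝ} (_ : R ∈ stdSimplex ℝ X) (p : ι → Prop) [DecidablePred p],
      ∑ a : {k // p k} → X, ∏ k, R (a k) = 1 := by
    intro R hR p _
    rw [sum_pi_prod (fun _ => R)]
    simp [hR.2]
  rw [← e.symm.sum_comp, Fintype.sum_prod_type]
  refine Finset.sum_congr rfl fun a _ => ?_
  -- The first block of `v` is never sent and sums out to one.
  have h4 : ∀ b, ∑ v : ι → X, (∏ k, P (e.symm (a, b) k)) * (∏ k, Q (v k)) *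
        Θ (fun k => if p k then e.symm (a, b) k else
          if c (fun k => e.symm (a, b) k) then v k else e.symm (a, b) k) =
      ∑ b' : {k // ¬p k} → X, (∏ k, P (a k)) * (∏ k, P (b k)) * (∏ k, Q (b' k)) *
        Θ (e.symm (a, if c a then b' else b)) := by
    intro b
    rw [← e.symm.sum_comp, Fintype.sum_prod_type]
    simp_rw [h2, h1]
    rw [Finset.sum_comm]
    refine Finset.sum_congr rfl fun b' _ => ?_
    calc _ = (∑ a' : {k // p k} → X, ∏ k, Q (a' k)) * ((∏ k, P (a k)) * (∏ k, P (b k)) *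
          (∏ k, Q (b' k)) * Θ (e.symm (a, if c a then b' else b))) := by
          rw [Finset.sum_mul]
          exact Finset.sum_congr rfl fun a' _ => by ring
      _ = _ := by rw [h3 hQ, one_mul]
  simp_rw [h4]
  -- Of the two candidate second blocks, the one not sent also sums out.
  by_cases hc : c a
  · simp only [hc, if_true]
    rw [Finset.sum_comm]
    refine Finset.sum_congr rfl fun b' _ => ?_
    calc _ = (∑ b : {k // ¬p k} → X, ∏ k, P (b k)) * ((∏ k, P (a k)) *
          (∏ k, Q (b' k)) * Θ (e.symm (a, b'))) := by
          rw [Finset.sum_mul]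
          exact Finset.sum_congr rfl fun a' _ => by ring
      _ = _ := by rw [h3 hP, one_mul]
  · simp only [hc, if_false]
    refine Finset.sum_congr rfl fun b _ => ?_
    calc _ = (∑ b' : {k // ¬p k} → X, ∏ k, Q (b' k)) * ((∏ k, P (a k)) *
          (∏ k, P (b k)) * Θ (e.symm (a, b))) := by
          rw [Finset.sum_mul]
          exact Finset.sum_congr rfl fun a' _ => by ring
      _ = _ := by rw [h3 hQ, one_mul]

end Switching

/-- Take logarithms. Positivity of every factor matters because `Real.log 0 = 0` would break the
passage from products to sums. -/
lemma sum_centeredDensity_le {X Y ι : Type*} [Fintype X] [Fintype Y] [Nonempty X] [Fintype ι]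
    (W : Channel X Y) {x : ι → X} {y : ι → Y} (hW : ∀ k, 0 < W.prob (x k) (y k))
    (hq : ∀ k, 0 < W.qStar (y k)) {t : ℝ}
    (h : ∏ k, W.prob (x k) (y k) ≤
      Real.exp (Fintype.card ι * W.capacity + t) * ∏ k, W.qStar (y k)) :
    ∑ k, W.centeredDensity (x k, y k) ≤ t := by
  have h1 : Real.exp (∑ k, W.infoDensity (x k) (y k)) =
      (∏ k, W.prob (x k) (y k)) / ∏ k, W.qStar (y k) := by
    rw [Real.exp_sum, ← Finset.prod_div_distrib]
    exact Finset.prod_congr rfl fun k _ => Real.exp_log (div_pos (hW k) (hq k))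
  have h2 : ∑ k, W.infoDensity (x k) (y k) ≤ Fintype.card ι * W.capacity + t := by
    rw [← Real.exp_le_exp, h1, div_le_iff₀ (Finset.prod_pos fun k _ => hq k)]
    exact h
  simp only [Channel.centeredDensity, Finset.sum_sub_distrib, Finset.sum_const, Finset.card_univ,
    nsmul_eq_mul]
  linarith

lemma piEquivPiSubtypeProd_symm_of_pos {ι Z : Type*} (p : ι → Prop) [DecidablePred p]
    (a : {k // p k} → Z) (b : {k // ¬p k} → Z) (k : {k // p k}) :
    (Equiv.piEquivPiSubtypeProd p fun _ => Z).symm (a, b) k = a k := by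
  simp [k.2]

lemma piEquivPiSubtypeProd_symm_of_neg {ι Z : Type*} (p : ι → Prop) [DecidablePred p]
    (a : {k // p k} → Z) (b : {k // ¬p k} → Z) (k : {k // ¬p k}) :
    (Equiv.piEquivPiSubtypeProd p fun _ => Z).symm (a, b) k = b k := by
  simp [k.2]

/-- The halfway switching set: the centered information density of the first half is at
most `t`. -/
def switchSet {X Y : Type*} [Fintype X] [Fintype Y] [Nonempty X] (W : Channel X Y) (n : ℕ)
    (t : ℝ) : Set ((Fin (n / 2) → X) × (Fin (n / 2) → Y)) :=
  {s | ∑ j, W.centeredDensity (s.1 j, s.2 j) ≤ t}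

open Classical in
/-- The inputs sent with the words `ω.1` and `ω.2` when the outputs are `y`. -/
def sentWord {X Y : Type*} {n : ℕ} (S : Set ((Fin (n / 2) → X) × (Fin (n / 2) → Y)))
    (ω : (Fin n → X) × (Fin n → X)) (y : Fin n → Y) (k : Fin n) : X :=
  if (k : ℕ) < n / 2 then ω.1 k
  else if ((fun j : Fin (n / 2) => ω.1 ⟨j, j.isLt.trans_le (Nat.div_le_self n 2)⟩),
      (fun j : Fin (n / 2) => y ⟨j, j.isLt.trans_le (Nat.div_le_self n 2)⟩)) ∈ S then ω.2 k
  else ω.1 k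

/-- The positions of the first half. -/
abbrev FirstHalf (n : ℕ) : Type := {k : Fin n // (k : ℕ) < n / 2}

/-- The positions after the first half. -/
abbrev SecondHalf (n : ℕ) : Type := {k : Fin n // ¬(k : ℕ) < n / 2}

/-- The natural numbering of the first half. -/
def firstHalfEquiv (n : ℕ) : Fin (n / 2) ≃ FirstHalf n where
  toFun j := ⟨⟨j, j.isLt.trans_le (Nat.div_le_self n 2)⟩, j.2⟩
  invFun k := ⟨k.1, k.2⟩
  left_inv _ := rfl
  right_inv _ := rfl

lemma card_firstHalf (n : ℕ) : Fintype.card (FirstHalf n) = n / 2 := by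
  rw [← Fintype.card_congr (firstHalfEquiv n), Fintype.card_fin]

lemma card_secondHalf (n : ℕ) : Fintype.card (SecondHalf n) = n - n / 2 := by
  rw [Fintype.card_subtype_compl, Fintype.card_fin, card_firstHalf]

/-- Both words of a message are merged into one random codeword, the form required by
`random_coding_bound`. After the halfway point the feedback prefix contains all first-half outputs,
so `sentWord` may read them from the full output. -/
lemma oneSwitchEnsembleError_eq {X Y : Type*} [Fintype X] [Fintype Y] (W : Channel X Y) (n M : ℕ)
    (S : Set ((Fin (n / 2) → X) × (Fin (n / 2) → Y))) (P Q : X → ℝ) :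
    oneSwitchEnsembleError W n M S P Q =
      ∑ w : Fin M → (Fin n → X) × (Fin n → X),
        (∏ m, ((∏ k, P ((w m).1 k)) * ∏ k, Q ((w m).2 k))) *
        (⨅ g : (Fin n → Y) → Fin M, (1 / (M : ℝ)) * ∑ m, ∑ y,
          if g y ≠ m then ∏ k, W.prob (sentWord S (w m) y k) (y k) else 0) := by
  rw [← (Equiv.arrowProdEquivProdArrow (Fin M) (fun _ => Fin n → X)
    (fun _ => Fin n → X)).symm.sum_comp, Fintype.sum_prod_type]
  refine Finset.sum_congr rfl fun a _ => Finset.sum_congr rfl fun b _ => ?_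
  rw [Finset.prod_mul_distrib]
  rfl

section Half

variable {X Y : Type*} [Fintype X] [Fintype Y] [Nonempty X] (W : Channel X Y) {P Q : X → ℝ}
  (n : ℕ) (t : ℝ)

-- Once the outputs are frozen, membership in the switching set depends only on the first-half
-- inputs, so `sum_switch_words` applies.
open Classical in
lemma sum_sentWord (hP : P ∈ stdSimplex ℝ X) (hQ : Q ∈ stdSimplex ℝ X) (s : FirstHalf n → Y)
    (s' : SecondHalf n → Y) (Θ : (Fin n → X) → ℝ) :
    ∑ ω : (Fin n → X) × (Fin n → X), ((∏ k, P (ω.1 k)) * ∏ k, Q (ω.2 k)) *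
      Θ (sentWord (switchSet W n t) ω
        ((Equiv.piEquivPiSubtypeProd (fun k : Fin n => (k : ℕ) < n / 2) fun _ => Y).symm (s, s'))) =
    ∑ a : FirstHalf n → X, ∑ b : SecondHalf n → X, (∏ k, P (a k)) *
      (∏ k, (if ∑ k, W.centeredDensity (a k, s k) ≤ t then Q else P) (b k)) *
      Θ ((Equiv.piEquivPiSubtypeProd (fun k : Fin n => (k : ℕ) < n / 2) fun _ => X).symm
        (a, b)) := by
  rw [← sum_switch_words hP hQ (fun k : Fin n => (k : ℕ) < n / 2)
    (fun a => ∑ k, W.centeredDensity (a k, s k) ≤ t) Θ, Fintype.sum_prod_type]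
  refine Finset.sum_congr rfl fun u _ => Finset.sum_congr rfl fun v _ => ?_
  congr 2
  funext k
  have h : ((fun j : Fin (n / 2) => u ⟨j, j.isLt.trans_le (Nat.div_le_self n 2)⟩),
      (fun j : Fin (n / 2) => (Equiv.piEquivPiSubtypeProd
        (fun k : Fin n => (k : ℕ) < n / 2) fun _ => Y).symm (s, s')
        ⟨j, j.isLt.trans_le (Nat.div_le_self n 2)⟩)) ∈ switchSet W n t ↔
      ∑ k : FirstHalf n, W.centeredDensity (u k, s k) ≤ t := by
    rw [← (firstHalfEquiv n).sum_comp]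
    simp [switchSet, firstHalfEquiv]
  simp only [sentWord, h]

omit [Fintype X] [Nonempty X] in
lemma prod_prob_split (x : Fin n → X) (y : Fin n → Y) :
    ∏ k, W.prob (x k) (y k) = (∏ k : FirstHalf n, W.prob (x k) (y k)) *
      ∏ k : SecondHalf n, W.prob (x k) (y k) :=
  (Fintype.prod_subtype_mul_prod_subtype (fun k : Fin n => (k : ℕ) < n / 2)
    fun k => W.prob (x k) (y k)).symm

lemma sum_prod_mul_prob {ι : Type*} [Fintype ι] [DecidableEq ι] (hP : P ∈ W.capAchieving)
    (y : ι → Y) :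
    ∑ a : ι → X, (∏ k, P (a k)) * ∏ k, W.prob (a k) (y k) = ∏ k, W.qStar (y k) := by
  simp_rw [← Finset.prod_mul_distrib]
  rw [sum_pi_prod fun k x => P x * W.prob x (y k)]
  exact Finset.prod_congr rfl fun k _ => (W.qStar_eq hP (y k)).symm

/-- For each fixed first half, the second half averages to the product of `q*` whether its letters
have law `P` or `Q`; the switching rule is thus invisible in the output law. -/
lemma sum_likelihood (hP : P ∈ W.capAchieving) (hQ : Q ∈ W.capAchieving) (y : Fin n → Y) :
    ∑ ω : (Fin n → X) × (Fin n → X), ((∏ k, P (ω.1 k)) * ∏ k, Q (ω.2 k)) *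
      ∏ k, W.prob (sentWord (switchSet W n t) ω y k) (y k) = ∏ k, W.qStar (y k) := by
  classical
  obtain ⟨⟨s, s'⟩, rfl⟩ := (Equiv.piEquivPiSubtypeProd (fun k : Fin n => (k : ℕ) < n / 2)
    fun _ => Y).symm.surjective y
  rw [sum_sentWord W n t hP.1 hQ.1 s s' (fun x => ∏ k, W.prob (x k)
    ((Equiv.piEquivPiSubtypeProd (fun k : Fin n => (k : ℕ) < n / 2) fun _ => Y).symm (s, s') k))]
  simp_rw [prod_prob_split, piEquivPiSubtypeProd_symm_of_pos, piEquivPiSubtypeProd_symm_of_neg]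
  rw [← Fintype.prod_subtype_mul_prod_subtype (fun k : Fin n => (k : ℕ) < n / 2)
    fun k => W.qStar _]
  simp_rw [piEquivPiSubtypeProd_symm_of_pos, piEquivPiSubtypeProd_symm_of_neg]
  rw [← sum_prod_mul_prob W hP, Finset.sum_mul]
  refine Finset.sum_congr rfl fun a _ => ?_
  have hR : (if ∑ k, W.centeredDensity (a k, s k) ≤ t then Q else P) ∈ W.capAchieving := by
    split_ifs <;> assumption
  rw [← sum_prod_mul_prob W hR, Finset.mul_sum]
  exact Finset.sum_congr rfl fun b _ => by ring

/-- The event that the first half falls below `T` and so does the total, in normalized sums. -/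
def lowLow (T : ℝ) : Set (ℝ × ℝ) := {p | p.1 ≤ T ∧ p.1 + p.2 ≤ T}

/-- The event that the first half is above `T` and the total below, in normalized sums. -/
def highLow (T : ℝ) : Set (ℝ × ℝ) := {p | T ≤ p.1 ∧ p.1 + p.2 ≤ T}

/-- `lowLow` and `highLow` share part of the line `p.1 = T`: both must be closed for the limit
theorem, and the overlap is harmless in an upper bound. -/
lemma isClosed_lowLow (T : ℝ) : IsClosed (lowLow T) :=
  (isClosed_le continuous_fst continuous_const).inter
    (isClosed_le (continuous_fst.add continuous_snd) continuous_const)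

lemma isClosed_highLow (T : ℝ) : IsClosed (highLow T) :=
  (isClosed_le continuous_const continuous_fst).inter
    (isClosed_le (continuous_fst.add continuous_snd) continuous_const)

open Classical in
/-- The probability that independent blocks with letter laws `w` and `w'` have normalized sums
in `F`. -/
def twoBlockProb {A : Type*} [Fintype A] (w w' ξ : A → ℝ) (n : ℕ) (F : Set (ℝ × ℝ)) : ℝ :=
  ∑ z : FirstHalf n → A, ∑ z' : SecondHalf n → A, (∏ k, w (z k)) * (∏ k, w' (z' k)) *
    if ((√(n : ℝ))⁻¹ * ∑ k, ξ (z k), (√(n : ℝ))⁻¹ * ∑ k, ξ (z' k)) ∈ F then 1 else 0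

lemma sum_arrow_prod {ι Z Z' : Type*} [Fintype ι] [DecidableEq ι] [Fintype Z] [Fintype Z']
    (f : (ι → Z × Z') → ℝ) :
    ∑ z, f z = ∑ a : ι → Z, ∑ s : ι → Z', f fun k => (a k, s k) := by
  rw [← (Equiv.arrowProdEquivProdArrow ι (fun _ => Z) (fun _ => Z')).symm.sum_comp,
    Fintype.sum_prod_type]
  rfl

open Classical in
lemma low_likelihood_term_le (hP : P ∈ W.capAchieving) (hQ : Q ∈ W.capAchieving) (hn : 0 < n)
    (T : ℝ) (a : FirstHalf n → X) (b : SecondHalf n → X) (s : FirstHalf n → Y)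
    (s' : SecondHalf n → Y) {x : Fin n → X} {y : Fin n → Y}
    (hx : x = (Equiv.piEquivPiSubtypeProd (fun k : Fin n => (k : ℕ) < n / 2) fun _ => X).symm
      (a, b))
    (hy : y = (Equiv.piEquivPiSubtypeProd (fun k : Fin n => (k : ℕ) < n / 2) fun _ => Y).symm
      (s, s')) :
    (∏ k, P (a k)) *
      (∏ k, (if ∑ k, W.centeredDensity (a k, s k) ≤ T * √n then Q else P) (b k)) *
      (if ∏ k, W.prob (x k) (y k) ≤ Real.exp (n * W.capacity + T * √n) * ∏ k, W.qStar (y k) then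
        ∏ k, W.prob (x k) (y k) else 0) ≤
    (∏ k, W.jointLaw P (a k, s k)) * (∏ k, W.jointLaw Q (b k, s' k)) *
      (if ((√(n : ℝ))⁻¹ * ∑ k, W.centeredDensity (a k, s k),
        (√(n : ℝ))⁻¹ * ∑ k, W.centeredDensity (b k, s' k)) ∈ lowLow T then 1 else 0) +
    (∏ k, W.jointLaw P (a k, s k)) * (∏ k, W.jointLaw P (b k, s' k)) *
      (if ((√(n : ℝ))⁻¹ * ∑ k, W.centeredDensity (a k, s k),
        (√(n : ℝ))⁻¹ * ∑ k, W.centeredDensity (b k, s' k)) ∈ highLow T then 1 else 0) := by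
  have hxa : ∀ k : FirstHalf n, x k = a k := fun k => by
    rw [hx, piEquivPiSubtypeProd_symm_of_pos]
  have hxb : ∀ k : SecondHalf n, x k = b k := fun k => by
    rw [hx, piEquivPiSubtypeProd_symm_of_neg]
  have hys : ∀ k : FirstHalf n, y k = s k := fun k => by
    rw [hy, piEquivPiSubtypeProd_symm_of_pos]
  have hys' : ∀ k : SecondHalf n, y k = s' k := fun k => by
    rw [hy, piEquivPiSubtypeProd_symm_of_neg]
  have hJ : ∀ {R : X → ℝ}, R ∈ W.capAchieving → ∀ z, 0 ≤ W.jointLaw R z := fun hR z =>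
    (W.jointLaw_mem hR.1).1 z
  have hnn1 : 0 ≤ (∏ k, W.jointLaw P (a k, s k)) * (∏ k, W.jointLaw Q (b k, s' k)) *
      (if ((√(n : ℝ))⁻¹ * ∑ k, W.centeredDensity (a k, s k),
        (√(n : ℝ))⁻¹ * ∑ k, W.centeredDensity (b k, s' k)) ∈ lowLow T then (1 : ℝ) else 0) :=
    mul_nonneg (mul_nonneg (Finset.prod_nonneg fun k _ => hJ hP _)
      (Finset.prod_nonneg fun k _ => hJ hQ _)) (by split_ifs <;> norm_num)
  have hnn2 : 0 ≤ (∏ k, W.jointLaw P (a k, s k)) * (∏ k, W.jointLaw P (b k, s' k)) *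
      (if ((√(n : ℝ))⁻¹ * ∑ k, W.centeredDensity (a k, s k),
        (√(n : ℝ))⁻¹ * ∑ k, W.centeredDensity (b k, s' k)) ∈ highLow T then (1 : ℝ) else 0) :=
    mul_nonneg (mul_nonneg (Finset.prod_nonneg fun k _ => hJ hP _)
      (Finset.prod_nonneg fun k _ => hJ hP _)) (by split_ifs <;> norm_num)
  set R := if ∑ k, W.centeredDensity (a k, s k) ≤ T * √n then Q else P with hR
  have hRc : R ∈ W.capAchieving := by rw [hR]; split_ifs <;> assumption
  by_cases hbad : ∏ k, W.prob (x k) (y k) ≤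
      Real.exp (n * W.capacity + T * √n) * ∏ k, W.qStar (y k)
  swap
  · rw [if_neg hbad, mul_zero]; exact add_nonneg hnn1 hnn2
  rw [if_pos hbad]
  have hprod : (∏ k, P (a k)) * (∏ k, R (b k)) * ∏ k, W.prob (x k) (y k) =
      (∏ k, W.jointLaw P (a k, s k)) * ∏ k, W.jointLaw R (b k, s' k) := by
    rw [prod_prob_split]
    simp_rw [hxa, hxb, hys, hys', Channel.jointLaw, Finset.prod_mul_distrib]
    ring
  rw [hprod]
  -- Terms of zero weight are trivial; otherwise all probabilities involved are positive and
  -- logarithms are legitimate.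
  by_cases h0 : (∏ k, W.jointLaw P (a k, s k)) * ∏ k, W.jointLaw R (b k, s' k) = 0
  · rw [h0]; exact add_nonneg hnn1 hnn2
  have hpos1 : ∀ k, 0 < P (a k) ∧ 0 < W.prob (a k) (s k) := by
    intro k
    have h := Finset.prod_ne_zero_iff.1 (mul_ne_zero_iff.1 h0).1 k (Finset.mem_univ k)
    have h' := mul_ne_zero_iff.1 h
    exact ⟨lt_of_le_of_ne (hP.1.1 _) h'.1.symm, lt_of_le_of_ne (W.prob_nonneg _ _) h'.2.symm⟩
  have hpos2 : ∀ k, 0 < R (b k) ∧ 0 < W.prob (b k) (s' k) := by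
    intro k
    have h := Finset.prod_ne_zero_iff.1 (mul_ne_zero_iff.1 h0).2 k (Finset.mem_univ k)
    have h' := mul_ne_zero_iff.1 h
    exact ⟨lt_of_le_of_ne (hRc.1.1 _) h'.1.symm, lt_of_le_of_ne (W.prob_nonneg _ _) h'.2.symm⟩
  have hall : ∀ k, 0 < W.prob (x k) (y k) ∧ 0 < W.qStar (y k) := by
    intro k
    by_cases hk : (k : ℕ) < n / 2
    · have e1 := hxa ⟨k, hk⟩
      have e2 := hys ⟨k, hk⟩
      simp only at e1 e2
      rw [e1, e2]
      exact ⟨(hpos1 _).2, W.qStar_pos hP (hpos1 _).1 (hpos1 _).2⟩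
    · have e1 := hxb ⟨k, hk⟩
      have e2 := hys' ⟨k, hk⟩
      simp only at e1 e2
      rw [e1, e2]
      exact ⟨(hpos2 _).2, W.qStar_pos hRc (hpos2 _).1 (hpos2 _).2⟩
  have hsum := sum_centeredDensity_le W (x := x) (y := y) (t := T * √n) (fun k => (hall k).1)
    (fun k => (hall k).2) (by rw [Fintype.card_fin]; exact hbad)
  rw [← Fintype.sum_subtype_add_sum_subtype (fun k : Fin n => (k : ℕ) < n / 2)] at hsum
  simp_rw [hxa, hxb, hys, hys'] at hsum
  have hsq : 0 < √(n : ℝ) := by positivity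
  have hdiv : ∀ {r : ℝ}, r ≤ T * √n → (√(n : ℝ))⁻¹ * r ≤ T := by
    intro r hr
    rw [inv_mul_le_iff₀ hsq, mul_comm]; exact hr
  have htot := hdiv hsum
  rw [mul_add] at htot
  by_cases hc : ∑ k, W.centeredDensity (a k, s k) ≤ T * √n
  · have hRQ : R = Q := by rw [hR, if_pos hc]
    have hmem : ((√(n : ℝ))⁻¹ * ∑ k, W.centeredDensity (a k, s k),
        (√(n : ℝ))⁻¹ * ∑ k, W.centeredDensity (b k, s' k)) ∈ lowLow T := ⟨hdiv hc, htot⟩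
    rw [if_pos hmem, mul_one, hRQ]
    exact le_add_of_nonneg_right hnn2
  · have hRP : R = P := by rw [hR, if_neg hc]
    have hmem : ((√(n : ℝ))⁻¹ * ∑ k, W.centeredDensity (a k, s k),
        (√(n : ℝ))⁻¹ * ∑ k, W.centeredDensity (b k, s' k)) ∈ highLow T := by
      refine ⟨?_, htot⟩
      rw [le_inv_mul_iff₀ hsq, mul_comm]
      exact (not_le.1 hc).le
    rw [if_pos hmem, mul_one, hRP]
    exact le_add_of_nonneg_left hnn1

open Classical in
lemma sum_low_likelihood_le (hP : P ∈ W.capAchieving) (hQ : Q ∈ W.capAchieving) (hn : 0 < n)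
    (T : ℝ) :
    ∑ y : Fin n → Y, ∑ ω : (Fin n → X) × (Fin n → X), ((∏ k, P (ω.1 k)) * ∏ k, Q (ω.2 k)) *
      (if ∏ k, W.prob (sentWord (switchSet W n (T * √n)) ω y k) (y k) ≤
        Real.exp (n * W.capacity + T * √n) * ∏ k, W.qStar (y k) then
        ∏ k, W.prob (sentWord (switchSet W n (T * √n)) ω y k) (y k) else 0) ≤
    twoBlockProb (W.jointLaw P) (W.jointLaw Q) W.centeredDensity n (lowLow T) +
      twoBlockProb (W.jointLaw P) (W.jointLaw P) W.centeredDensity n (highLow T) := by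
  have hswap : ∀ G : (FirstHalf n → X) → (FirstHalf n → Y) → (SecondHalf n → X) →
      (SecondHalf n → Y) → ℝ, ∑ a, ∑ s, ∑ b, ∑ s', G a s b s' =
      ∑ s, ∑ s', ∑ a, ∑ b, G a s b s' := by
    intro G
    rw [Finset.sum_comm]
    refine Finset.sum_congr rfl fun s _ => ?_
    calc _ = ∑ a, ∑ s', ∑ b, G a s b s' := Finset.sum_congr rfl fun a _ => Finset.sum_comm
      _ = _ := Finset.sum_comm
  rw [← (Equiv.piEquivPiSubtypeProd (fun k : Fin n => (k : ℕ) < n / 2)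
    fun _ => Y).symm.sum_comp, Fintype.sum_prod_type]
  have hblock : ∀ (Q : X → ℝ) (F : Set (ℝ × ℝ)),
      twoBlockProb (W.jointLaw P) (W.jointLaw Q) W.centeredDensity n F =
      ∑ s : FirstHalf n → Y, ∑ s' : SecondHalf n → Y, ∑ a : FirstHalf n → X,
        ∑ b : SecondHalf n → X,
        (∏ k, W.jointLaw P (a k, s k)) * (∏ k, W.jointLaw Q (b k, s' k)) *
        (if ((√(n : ℝ))⁻¹ * ∑ k, W.centeredDensity (a k, s k),
          (√(n : ℝ))⁻¹ * ∑ k, W.centeredDensity (b k, s' k)) ∈ F then 1 else 0) := by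
    intro Q F
    rw [twoBlockProb, sum_arrow_prod]
    simp_rw [sum_arrow_prod (ι := SecondHalf n)]
    exact hswap _
  rw [hblock Q, hblock P]
  simp_rw [← Finset.sum_add_distrib]
  refine Finset.sum_le_sum fun s _ => Finset.sum_le_sum fun s' _ => ?_
  rw [sum_sentWord W n (T * √n) hP.1 hQ.1 s s' (fun x => if ∏ k, W.prob (x k)
    ((Equiv.piEquivPiSubtypeProd (fun k : Fin n => (k : ℕ) < n / 2) fun _ => Y).symm (s, s') k) ≤
      Real.exp (n * W.capacity + T * √n) * ∏ k, W.qStar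
        ((Equiv.piEquivPiSubtypeProd (fun k : Fin n => (k : ℕ) < n / 2) fun _ => Y).symm (s, s') k)
      then ∏ k, W.prob (x k)
    ((Equiv.piEquivPiSubtypeProd (fun k : Fin n => (k : ℕ) < n / 2) fun _ => Y).symm (s, s') k)
      else 0)]
  exact Finset.sum_le_sum fun a _ => Finset.sum_le_sum fun b _ =>
    low_likelihood_term_le W n hP hQ hn T a b s s' rfl rfl

/-- Switching and decoding use the same threshold `T√n`: the switch occurs exactly when the second
half must make up a nonnegative deficit, which is where extra variance helps. -/
lemma oneSwitchEnsembleError_le (hP : P ∈ W.capAchieving) (hQ : Q ∈ W.capAchieving) (hn : 0 < n)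
    {M : ℕ} (hM : 0 < M) (T : ℝ) :
    oneSwitchEnsembleError W n M (switchSet W n (T * √n)) P Q ≤
      twoBlockProb (W.jointLaw P) (W.jointLaw Q) W.centeredDensity n (lowLow T) +
      twoBlockProb (W.jointLaw P) (W.jointLaw P) W.centeredDensity n (highLow T) +
      (M - 1) / Real.exp (n * W.capacity + T * √n) := by
  classical
  have hp : (fun ω : (Fin n → X) × (Fin n → X) => (∏ k, P (ω.1 k)) * ∏ k, Q (ω.2 k)) ∈
      stdSimplex ℝ ((Fin n → X) × (Fin n → X)) := by
    refine ⟨fun ω => mul_nonneg (Finset.prod_nonneg fun k _ => hP.1.1 _)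
      (Finset.prod_nonneg fun k _ => hQ.1.1 _), ?_⟩
    rw [Fintype.sum_prod_type]
    simp_rw [← Finset.mul_sum, ← Finset.sum_mul]
    rw [sum_pi_prod fun _ => P, sum_pi_prod fun _ => Q]
    simp [hP.1.2, hQ.1.2]
  rw [oneSwitchEnsembleError_eq]
  refine (random_coding_bound hM hp
    (L := fun ω y => ∏ k, W.prob (sentWord (switchSet W n (T * √n)) ω y k) (y k))
    (fun ω y => Finset.prod_nonneg fun k _ => W.prob_nonneg _ _)
    (q := fun y => ∏ k, W.qStar (y k)) ?_ (fun y => sum_likelihood W n _ hP hQ y)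
    (Real.exp_pos (n * W.capacity + T * √n))).trans ?_
  · rw [sum_pi_prod fun _ => W.qStar]
    simp [W.sum_qStar]
  · have := sum_low_likelihood_le W n hP hQ hn T
    gcongr

end Half

/-! ### From the random ensemble to the best feedback code. -/

section FeedbackCodes

variable {X Y : Type*} [Fintype X] [Fintype Y]

-- The last input depends only on earlier outputs, so the last output sums out to one; then
-- induction.
omit [Fintype X] in
lemma sum_prod_feedback (W : Channel X Y) (n : ℕ) (f : (k : Fin n) → (Fin k → Y) → X) :
    ∑ y : Fin n → Y, ∏ k : Fin n, W.prob (f k fun j => y ⟨j, j.isLt.trans k.isLt⟩) (y k) = 1 := by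
  induction n with
  | zero => simp
  | succ n ih =>
    rw [← (Fin.snocEquiv fun _ => Y).sum_comp, Fintype.sum_prod_type, Finset.sum_comm]
    rw [← ih fun k => f k.castSucc]
    refine Finset.sum_congr rfl fun y _ => ?_
    have h : ∀ b : Y, ∏ k : Fin (n + 1),
        W.prob (f k fun j => (Fin.snocEquiv fun _ => Y) (b, y) ⟨j, j.isLt.trans k.isLt⟩)
          ((Fin.snocEquiv fun _ => Y) (b, y) k) =
        (∏ k : Fin n, W.prob (f k.castSucc fun j => y ⟨j, j.isLt.trans k.isLt⟩) (y k)) *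
          W.prob (f (Fin.last n) y) b := by
      intro b
      have hs : ∀ k : Fin n, (Fin.snocEquiv fun _ => Y) (b, y) k.castSucc = y k := fun k => by
        simp [Fin.snocEquiv]
      have hl : (Fin.snocEquiv fun _ => Y) (b, y) (Fin.last n) = b := by simp [Fin.snocEquiv]
      rw [Fin.prod_univ_castSucc, hl]
      congr 1
      · refine Finset.prod_congr rfl fun k _ => ?_
        rw [hs]
        congr 2
        funext j
        exact hs ⟨j, j.isLt.trans k.isLt⟩
      · congr 2
        funext j
        exact hs ⟨j, j.isLt⟩
    simp_rw [h]
    rw [← Finset.mul_sum, W.prob_sum, mul_one]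
    rfl

omit [Fintype X] in
lemma avgError_nonneg (W : Channel X Y) {n M : ℕ} (c : FeedbackCode X Y n M) :
    0 ≤ avgError W c := by
  refine mul_nonneg (by positivity) (Finset.sum_nonneg fun m _ => Finset.sum_nonneg fun y _ => ?_)
  split_ifs
  · exact Finset.prod_nonneg fun k _ => W.prob_nonneg _ _
  · exact le_rfl

omit [Fintype X] in
lemma prob_le_one (W : Channel X Y) (x : X) (y : Y) : W.prob x y ≤ 1 := by
  rw [← W.prob_sum x]
  exact Finset.single_le_sum (fun y _ => W.prob_nonneg x y) (Finset.mem_univ y)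

-- Each output sequence is decoded to a single message, so it adds at most one to the
-- correct-decoding probabilities summed over messages.
omit [Fintype X] in
lemma le_avgError (W : Channel X Y) {n M : ℕ} (hM : 0 < M) (c : FeedbackCode X Y n M) :
    1 - (Fintype.card (Fin n → Y) : ℝ) / M ≤ avgError W c := by
  classical
  have hM' : (0 : ℝ) < M := by exact_mod_cast hM
  set p : Fin M → (Fin n → Y) → ℝ := fun m y =>
    ∏ k : Fin n, W.prob (c.encoder m k fun j => y ⟨j, j.isLt.trans k.isLt⟩) (y k) with hp
  have h1 : ∀ m y, p m y - (if c.decoder y = m then 1 else 0) ≤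
      if c.decoder y ≠ m then p m y else 0 := by
    intro m y
    have : p m y ≤ 1 := Finset.prod_le_one (fun k _ => W.prob_nonneg _ _)
      fun k _ => prob_le_one W _ _
    by_cases h : c.decoder y = m
    · simpa [h] using this
    · simp [h]
  have h2 : (M : ℝ) - Fintype.card (Fin n → Y) ≤
      ∑ m : Fin M, ∑ y, if c.decoder y ≠ m then p m y else 0 := by
    calc (M : ℝ) - Fintype.card (Fin n → Y)
        = ∑ m : Fin M, ∑ y, (p m y - if c.decoder y = m then 1 else 0) := by
          simp_rw [Finset.sum_sub_distrib]
          congr 1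
          · simp_rw [hp, sum_prod_feedback W n (c.encoder _)]
            simp
          · rw [Finset.sum_comm]
            simp
      _ ≤ _ := Finset.sum_le_sum fun m _ => Finset.sum_le_sum fun y _ => h1 m y
  rw [avgError, one_div, le_inv_mul_iff₀ hM', mul_sub, mul_one, mul_div_cancel₀ _ hM'.ne']
  exact h2

-- Needed because `sSup` of an unbounded set of naturals is `0`.
omit [Fintype X] in
lemma bddAbove_messages (W : Channel X Y) [Nonempty X] (n : ℕ) {ε : ℝ} (hε : ε < 1) :
    BddAbove {M : ℕ | ∃ R : ℝ, M = ⌈Real.exp (n * R)⌉₊ ∧ minErrorFb W n R ≤ ε} := by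
  refine ⟨⌈(Fintype.card (Fin n → Y) : ℝ) * (2 / (1 - ε))⌉₊, ?_⟩
  rintro M ⟨R, hMR, hR⟩
  have hM : 0 < M := by rw [hMR]; exact Nat.ceil_pos.2 (Real.exp_pos _)
  rw [minErrorFb, ← hMR] at hR
  have : Nonempty (FeedbackCode X Y n M) :=
    ⟨⟨fun _ _ _ => Classical.arbitrary X, fun _ => ⟨0, hM⟩⟩⟩
  -- The midpoint `(1 + ε) / 2` leaves room above `ε`, so that attainment of the infimum over codes
  -- is not needed.
  obtain ⟨c, hc⟩ := exists_lt_of_ciInf_lt (hR.trans_lt (show ε < (1 + ε) / 2 by linarith))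
  have h := (le_avgError W hM c).trans hc.le
  have hM' : (0 : ℝ) < M := by exact_mod_cast hM
  have h1 : (1 - ε) / 2 ≤ (Fintype.card (Fin n → Y) : ℝ) / M := by linarith
  have h2 : (M : ℝ) ≤ Fintype.card (Fin n → Y) * (2 / (1 - ε)) := by
    rw [le_div_iff₀ hM'] at h1
    rw [mul_div_assoc', le_div_iff₀ (by linarith)]
    linarith
  exact_mod_cast h2.trans (Nat.le_ceil _)

/-- A mean at most `ε` cannot come from values all above `ε`. There are finitely many decoders, so
the optimal one is attained. -/
lemma exists_code_of_ensembleError_le (W : Channel X Y) {n M : ℕ} (hM : 0 < M)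
    (S : Set ((Fin (n / 2) → X) × (Fin (n / 2) → Y))) {P Q : X → ℝ} (hP : P ∈ stdSimplex ℝ X)
    (hQ : Q ∈ stdSimplex ℝ X) {ε : ℝ} (h : oneSwitchEnsembleError W n M S P Q ≤ ε) :
    ∃ c : FeedbackCode X Y n M, avgError W c ≤ ε := by
  by_contra! hc
  have : Nonempty (Fin M) := ⟨⟨0, hM⟩⟩
  have hinf : ∀ a b : Fin M → Fin n → X,
      ε < ⨅ g : (Fin n → Y) → Fin M, avgError W ⟨oneSwitchEncoder S a b, g⟩ := by
    intro a b
    obtain ⟨g, hg⟩ := exists_eq_ciInf_of_finite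
      (f := fun g : (Fin n → Y) → Fin M => avgError W ⟨oneSwitchEncoder S a b, g⟩)
    rw [← hg]
    exact hc _
  have hone : ∀ {R : X → ℝ}, R ∈ stdSimplex ℝ X →
      ∑ a : Fin M → Fin n → X, ∏ m, ∏ k, R (a m k) = 1 := by
    intro R hR
    rw [sum_pi_prod (fun (_ : Fin M) (u : Fin n → X) => ∏ k, R (u k)), sum_pi_prod fun _ => R]
    simp [hR.2]
  have hnn : ∀ a b : Fin M → Fin n → X,
      0 ≤ (∏ m, ∏ k, P (a m k)) * ∏ m, ∏ k, Q (b m k) := fun a b =>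
    mul_nonneg (Finset.prod_nonneg fun m _ => Finset.prod_nonneg fun k _ => hP.1 _)
      (Finset.prod_nonneg fun m _ => Finset.prod_nonneg fun k _ => hQ.1 _)
  have hterm : ∀ a b : Fin M → Fin n → X,
      0 ≤ ((∏ m, ∏ k, P (a m k)) * ∏ m, ∏ k, Q (b m k)) *
        ((⨅ g : (Fin n → Y) → Fin M, avgError W ⟨oneSwitchEncoder S a b, g⟩) - ε) := fun a b =>
    mul_nonneg (hnn a b) (by linarith [hinf a b])
  have htot : ∑ a : Fin M → Fin n → X, ∑ b : Fin M → Fin n → X,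
      ((∏ m, ∏ k, P (a m k)) * ∏ m, ∏ k, Q (b m k)) = 1 := by
    simp_rw [← Finset.mul_sum, ← Finset.sum_mul]
    rw [hone hP, hone hQ, one_mul]
  have hsum : ∑ a : Fin M → Fin n → X, ∑ b : Fin M → Fin n → X,
      ((∏ m, ∏ k, P (a m k)) * ∏ m, ∏ k, Q (b m k)) *
        ((⨅ g : (Fin n → Y) → Fin M, avgError W ⟨oneSwitchEncoder S a b, g⟩) - ε) ≤ 0 := by
    simp_rw [mul_sub, Finset.sum_sub_distrib, ← Finset.sum_mul]
    rw [htot, one_mul]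
    rw [oneSwitchEnsembleError] at h
    linarith
  have hzero := le_antisymm hsum
    (Finset.sum_nonneg fun a _ => Finset.sum_nonneg fun b _ => hterm a b)
  have hw : ∀ a b : Fin M → Fin n → X, (∏ m, ∏ k, P (a m k)) * ∏ m, ∏ k, Q (b m k) = 0 := by
    intro a b
    have h1 := (Finset.sum_eq_zero_iff_of_nonneg fun a _ =>
      Finset.sum_nonneg fun b _ => hterm a b).1 hzero a (Finset.mem_univ a)
    have h2 := (Finset.sum_eq_zero_iff_of_nonneg fun b _ => hterm a b).1 h1 b (Finset.mem_univ b)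
    exact (mul_eq_zero.1 h2).resolve_right (by linarith [hinf a b])
  simp_rw [hw] at htot
  simp at htot

lemma le_secondOrderRateFb (W : Channel X Y) [Nonempty X] {ε : ℝ} (hε : ε < 1) {P Q : X → ℝ}
    (hP : P ∈ stdSimplex ℝ X) (hQ : Q ∈ stdSimplex ℝ X)
    (S : (n : ℕ) → Set ((Fin (n / 2) → X) × (Fin (n / 2) → Y))) {T : ℝ}
    (h : ∀ r < T, ∀ᶠ n : ℕ in atTop, oneSwitchEnsembleError W n
      ⌈Real.exp (n * W.capacity + r * √(n : ℝ))⌉₊ (S n) P Q ≤ ε) :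
    (T : EReal) ≤ secondOrderRateFb W ε := by
  refine le_of_forall_lt fun c hc => ?_
  obtain ⟨r, hcr, hrT⟩ := EReal.lt_iff_exists_real_btwn.1 hc
  refine hcr.trans_le (le_liminf_of_le (by isBoundedDefault) ?_)
  filter_upwards [h r (by exact_mod_cast hrT), eventually_gt_atTop 0] with n hn hn0
  have hsq : 0 < √(n : ℝ) := by positivity
  have hsq2 : √(n : ℝ) * √(n : ℝ) = n := Real.mul_self_sqrt (by positivity)
  -- Chosen so that `nR = nC + r√n`.
  set R : ℝ := W.capacity + r / √(n : ℝ) with hR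
  have hnR : n * R = n * W.capacity + r * √(n : ℝ) := by
    rw [hR, mul_add]
    congr 1
    rw [mul_div_assoc', div_eq_iff hsq.ne', mul_assoc, hsq2, mul_comm]
  rw [← hnR] at hn
  obtain ⟨c, hc⟩ := exists_code_of_ensembleError_le W
    (Nat.ceil_pos.2 (Real.exp_pos (n * R))) (S n) hP hQ hn
  have hmin : minErrorFb W n R ≤ ε := by
    refine (ciInf_le ⟨0, ?_⟩ c).trans hc
    rintro _ ⟨c, rfl⟩
    exact avgError_nonneg W c
  have hle : ⌈Real.exp (n * R)⌉₊ ≤ maxMessagesFb W n ε :=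
    le_csSup (bddAbove_messages W n hε) ⟨R, rfl, hmin⟩
  have hexp : Real.exp (n * R) ≤ (maxMessagesFb W n ε : ℝ) :=
    (Nat.le_ceil _).trans (by exact_mod_cast hle)
  have hlog : n * R ≤ Real.log (maxMessagesFb W n ε) := by
    rw [← Real.log_exp (n * R)]
    exact Real.log_le_log (Real.exp_pos _) hexp
  rw [EReal.coe_le_coe_iff, le_div_iff₀ hsq]
  linarith

end FeedbackCodes

/-! ### Asymptotics and the choice of the threshold. -/

lemma tendsto_card_firstHalf_div :
    Tendsto (fun n : ℕ => (Fintype.card (FirstHalf n) : ℝ) / n) atTop (𝓝 (1 / 2)) := by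
  simp_rw [card_firstHalf]
  have h := (tendsto_nat_floor_mul_div_atTop (R := ℝ) (a := 1 / 2) (by norm_num)).comp
    tendsto_natCast_atTop_atTop
  refine h.congr fun n => ?_
  have : ⌊(1 / 2 : ℝ) * n⌋₊ = n / 2 := by
    rw [one_div_mul_eq_div]
    exact (Nat.floor_div_ofNat (n : ℝ) 2).trans (by rw [Nat.floor_natCast])
  simp [← this]

lemma tendsto_card_secondHalf_div :
    Tendsto (fun n : ℕ => (Fintype.card (SecondHalf n) : ℝ) / n) atTop (𝓝 (1 / 2)) := by
  have h := tendsto_card_firstHalf_div.const_sub 1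
  rw [show (1 : ℝ) - 1 / 2 = 1 / 2 by norm_num] at h
  refine h.congr' ?_
  filter_upwards [eventually_gt_atTop 0] with n hn
  have : (n : ℝ) ≠ 0 := by positivity
  rw [card_firstHalf, card_secondHalf, Nat.cast_sub (Nat.div_le_self n 2), sub_div, div_self this]

/-- Subtracting one absorbs the ceiling, so the ratio is at most `exp((r - T)√n)`. -/
lemma tendsto_excess_messages_div (C : ℝ) {r T : ℝ} (h : r < T) :
    Tendsto (fun n : ℕ => ((⌈Real.exp (n * C + r * √(n : ℝ))⌉₊ : ℝ) - 1) /
      Real.exp (n * C + T * √(n : ℝ))) atTop (𝓝 0) := by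
  have hlim : Tendsto (fun n : ℕ => Real.exp ((r - T) * √(n : ℝ))) atTop (𝓝 0) :=
    Real.tendsto_exp_atBot.comp ((Real.tendsto_sqrt_atTop.comp
      tendsto_natCast_atTop_atTop).const_mul_atTop_of_neg (by linarith))
  refine squeeze_zero (fun n => ?_) (fun n => ?_) hlim
  · have : 1 ≤ ⌈Real.exp (n * C + r * √(n : ℝ))⌉₊ := Nat.ceil_pos.2 (Real.exp_pos _)
    have : (1 : ℝ) ≤ (⌈Real.exp (n * C + r * √(n : ℝ))⌉₊ : ℝ) := by exact_mod_cast this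
    exact div_nonneg (by linarith) (Real.exp_pos _).le
  · rw [div_le_iff₀ (Real.exp_pos _), ← Real.exp_add]
    have := Nat.ceil_lt_add_one (Real.exp_pos (n * C + r * √(n : ℝ))).le
    rw [show (r - T) * √(n : ℝ) + (n * C + T * √(n : ℝ)) = n * C + r * √(n : ℝ) by ring]
    linarith

section Achievability

variable {X Y : Type*} [Fintype X] [Nonempty X] [Fintype Y] (W : Channel X Y)

lemma eventually_twoBlockProb_lt {P Q : X → ℝ} (hP : P ∈ W.capAchieving)
    (hQ : Q ∈ W.capAchieving) (hVP : 0 < W.dispersion P) (hVQ : 0 < W.dispersion Q)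
    {F : Set (ℝ × ℝ)} (hF : IsClosed F) {b : ℝ}
    (hb : ((gaussianReal 0 1).prod (gaussianReal 0 1)).real
      {p | (√(W.dispersion P * (1 / 2)) * p.1, √(W.dispersion Q * (1 / 2)) * p.2) ∈ F} < b) :
    ∀ᶠ n : ℕ in atTop,
      twoBlockProb (W.jointLaw P) (W.jointLaw Q) W.centeredDensity n F < b :=
  eventually_two_block_sum_le (W.jointLaw_mem hP.1) (W.jointLaw_mem hQ.1) hVP hVQ (by norm_num)
    (by norm_num) (W.sum_jointLaw_mul_centeredDensity hP) (W.sum_jointLaw_mul_centeredDensity hQ)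
    (W.sum_jointLaw_mul_centeredDensity_sq hP) (W.sum_jointLaw_mul_centeredDensity_sq hQ)
    FirstHalf SecondHalf tendsto_card_firstHalf_div tendsto_card_secondHalf_div hF hb

lemma eventually_oneSwitchEnsembleError_le (hV : 0 < W.Vmin) {ε α : ℝ} (hε : 0 < ε)
    (hα : 1 < α) (hα' : α < 1 / (2 * ε)) (hgap : coarseGap W ε α < 0) {P Q : X → ℝ}
    (hP : P ∈ W.capAchieving) (hQ : Q ∈ W.capAchieving) (hVP : W.dispersion P = W.Vmin)
    (hVQ : W.dispersion Q = W.Vmax) {r : ℝ} (hr : r < √W.Vmin * gaussianQuantile (α * ε)) :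
    ∀ᶠ n : ℕ in atTop, oneSwitchEnsembleError W n
      ⌈Real.exp (n * W.capacity + r * √(n : ℝ))⌉₊
      (switchSet W n (√W.Vmin * gaussianQuantile (α * ε) * √n)) P Q ≤ ε := by
  have hαε : 0 < α * ε := by positivity
  have hαε' : α * ε < 1 / 2 := by
    rw [lt_div_iff₀ (by positivity)] at hα'
    linarith
  have hVmax : 0 < W.Vmax := hV.trans_le W.Vmin_le_Vmax
  set c := gaussianQuantile (α * ε) with hc
  set T := √W.Vmin * c with hT
  have hc0 : c < 0 := gaussianQuantile_neg hαε hαε'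
  -- In units of the first-half deviation `s` the threshold `T` is `-d`; the `√2` appears because
  -- half a block carries half the variance.
  set d := -(√2 * c) with hd
  have h2 : 0 < √(2 : ℝ) := by positivity
  have hd0 : 0 ≤ d := by rw [hd]; nlinarith
  set s := √(W.Vmin * (1 / 2)) with hs
  set t := √(W.Vmax * (1 / 2)) with ht
  have hs0 : 0 < s := by positivity
  have ht0 : 0 < t := by positivity
  have hsd : T = -(s * d) := by
    have : s * √2 = √W.Vmin := by
      rw [hs, ← Real.sqrt_mul (by positivity)]
      congr 1; ring
    rw [hT, hd, ← this]; ring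
  set β := √(W.Vmin / W.Vmax) with hβ
  have hβst : β = s / t := by
    rw [hβ, hs, ht, ← Real.sqrt_div (by positivity)]
    congr 1; field_simp
  have hβ1 : β ≤ 1 := by
    rw [hβ, Real.sqrt_le_one]
    exact div_le_one_of_le₀ W.Vmin_le_Vmax hVmax.le
  set A₁ := ((gaussianReal 0 1).prod (gaussianReal 0 1)).real
    {p | (s * p.1, t * p.2) ∈ lowLow T} with hA₁
  set A₂ := ((gaussianReal 0 1).prod (gaussianReal 0 1)).real
    {p | (s * p.1, s * p.2) ∈ highLow T} with hA₂
  have hset₁ : {p : ℝ × ℝ | (s * p.1, t * p.2) ∈ lowLow T} =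
      {p | p.1 ∈ Iic (-d) ∧ p.2 ≤ β * (-d - p.1)} := by
    ext p
    change (s * p.1 ≤ T ∧ s * p.1 + t * p.2 ≤ T) ↔ (p.1 ≤ -d ∧ p.2 ≤ β * (-d - p.1))
    have e1 : s * p.1 ≤ T ↔ p.1 ≤ -d := by
      rw [hsd, ← mul_neg, mul_le_mul_iff_right₀ hs0]
    have e2 : s * p.1 + t * p.2 ≤ T ↔ p.2 ≤ β * (-d - p.1) := by
      rw [hβst, div_mul_eq_mul_div, le_div_iff₀ ht0, hsd]
      constructor <;> intro h <;> linarith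
    rw [e1, e2]
  have hset₂ : {p : ℝ × ℝ | (s * p.1, s * p.2) ∈ highLow T} =
      {p | p.1 ∈ Ici (-d) ∧ p.2 ≤ -d - p.1} := by
    ext p
    change (T ≤ s * p.1 ∧ s * p.1 + s * p.2 ≤ T) ↔ (-d ≤ p.1 ∧ p.2 ≤ -d - p.1)
    have e1 : T ≤ s * p.1 ↔ -d ≤ p.1 := by
      rw [hsd, ← mul_neg, mul_le_mul_iff_right₀ hs0]
    have e2 : s * p.1 + s * p.2 ≤ T ↔ p.2 ≤ -d - p.1 := by
      rw [hsd, ← mul_neg, ← mul_add, mul_le_mul_iff_right₀ hs0]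
      constructor <;> intro h <;> linarith
    rw [e1, e2]
  -- The limiting error is at most `Φ(c) = αε` minus the gain, and the sign of `coarseGap` puts this
  -- below `ε`.
  have hA : A₁ + A₂ < ε := by
    have h := prod_gaussian_switch_le (β := β) (Real.sqrt_nonneg _) hβ1 hd0
    rw [← hset₁, ← hset₂] at h
    have e1 : -d / √2 = c := by rw [hd]; field_simp
    have e2 : 2 * d = -(2 * √2 * c) := by rw [hd]; ring
    rw [e1, e2, gaussianDensity_neg, hd, gaussianDensity_neg, hc,
      gaussianCDF_quantile hαε (by linarith), ← hc, gaussianDensity_zero] at h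
    rw [coarseGap] at hgap
    linarith
  -- The slack is shared by the two Gaussian approximations and the competing-codeword term.
  set δ := (ε - (A₁ + A₂)) / 3 with hδ
  have hδ0 : 0 < δ := by rw [hδ]; linarith
  have h₁ := eventually_twoBlockProb_lt W hP hQ (hVP ▸ hV) (hVQ ▸ hVmax) (isClosed_lowLow T)
    (b := A₁ + δ) (by rw [hVP, hVQ]; linarith)
  have h₂ := eventually_twoBlockProb_lt W hP hP (hVP ▸ hV) (hVP ▸ hV) (isClosed_highLow T)
    (b := A₂ + δ) (by rw [hVP]; linarith)
  have h₃ := (tendsto_excess_messages_div W.capacity hr).eventually_lt_const hδ0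
  filter_upwards [h₁, h₂, h₃, eventually_gt_atTop 0] with n g₁ g₂ g₃ hn
  refine (oneSwitchEnsembleError_le W n hP hQ hn (Nat.ceil_pos.2 (Real.exp_pos _)) T).trans ?_
  linarith

end Achievability

end

theorem theorem1 {X Y : Type*} [Fintype X] [Nonempty X] [Fintype Y] (W : Channel X Y)
    (hW : W.IsCompoundDispersion) (ε : ℝ) (hε : 0 < ε) (hε' : ε < 1 / 2) :
    (∃ α : ℝ, 1 < α ∧ α < 1 / (2 * ε) ∧ coarseGap W ε α < 0) ∧
    ∀ α : ℝ, 1 < α → α < 1 / (2 * ε) → coarseGap W ε α < 0 →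
      ((√W.Vmin * gaussianQuantile (α * ε) : ℝ) : EReal) ≤ secondOrderRateFb W ε ∧
      √W.Vmin * gaussianQuantile ε < √W.Vmin * gaussianQuantile (α * ε) ∧
      ∃ P ∈ W.capAchieving, ∃ Q ∈ W.capAchieving,
        W.dispersion P = W.Vmin ∧ W.dispersion Q = W.Vmax ∧
        ∃ S : (n : ℕ) → Set ((Fin (n / 2) → X) × (Fin (n / 2) → Y)),
          ∀ r : ℝ, r < √W.Vmin * gaussianQuantile (α * ε) →
            ∀ᶠ n : ℕ in Filter.atTop,
              oneSwitchEnsembleError W n ⌈Real.exp (n * W.capacity + r * √(n : ℝ))⌉₊ (S n) P Q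
                ≤ ε := by
  obtain ⟨hV, hne⟩ := hW
  have hlt : W.Vmin < W.Vmax := lt_of_le_of_ne W.Vmin_le_Vmax hne
  refine ⟨?_, fun α hα hα' hgap => ?_⟩
  · refine exists_coarse_gain hε hε' ?_
    rw [Real.sqrt_lt' one_pos, one_pow, div_lt_one (hV.trans hlt)]
    exact hlt
  · obtain ⟨P, hP, hVP⟩ := W.exists_dispersion_eq_Vmin
    obtain ⟨Q, hQ, hVQ⟩ := W.exists_dispersion_eq_Vmax
    have hS := fun r (hr : r < √W.Vmin * gaussianQuantile (α * ε)) =>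
      eventually_oneSwitchEnsembleError_le W hV hε hα hα' hgap hP hQ hVP hVQ hr
    refine ⟨le_secondOrderRateFb W (by linarith) hP.1 hQ.1 _ hS, ?_, P, hP, Q, hQ, hVP, hVQ, _, hS⟩
    have hαε : α * ε < 1 := by
      rw [lt_div_iff₀ (by positivity)] at hα'
      linarith
    exact mul_lt_mul_of_pos_left (gaussianQuantile_lt hε (by nlinarith) hαε) (by positivity)
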